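/- Let $K$ be a field of characteristic $0$ and let $(A,d,\cdot,\Delta)$ be a (not necessarily unital, $\mathbb{Z}$-graded) $\mathrm{BV}$-algebra over $K$: $(A,d,\cdot)$ is a dg-commutative algebra with $|d|=+1$, $\Delta$ is an operator of degree $-1$ with $\Delta^2=d\Delta+\Delta d=0$, and for every homogeneous $x$ the operation $[x,-]$, where $[x,y]=(-1)^{|x|}\big(\Delta(xy)-\Delta(x)y-(-1)^{|x|}x\Delta(y)\big)$, is a derivation of degree $|x|-1$ of the product. Assume that $A$ is a $\mathrm{BV}_1$-algebra, i.e. $\Delta$ is itself a derivation, $\Delta(xy)=\Delta(x)y+(-1)^{|x|}x\Delta(y)$, and that $A$ satisfies the $d\Delta$-condition $$\mathrm{Ker}(d)\cap\mathrm{Im}(\Delta)=\mathrm{Ker}(\Delta)\cap\mathrm{Im}(d)=\mathrm{Im}(d\Delta).$$ Let $H=\mathrm{Ker}(d)/\mathrm{Im}(d)$. A homotopy transfer diagram consists of degree-$0$ linear maps $\iota:H\to A$, $\rho:A\to H$ and a degree-$(-1)$ map $h:A\to A$ with $d\iota=0$, $\rho d=0$, $\rho\iota=\mathrm{Id}$ and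 $dh+hd=\mathrm{Id}-\iota\rho$; call it compatible if $\Delta\iota=0$, $\rho\Delta=0$ and $h\Delta+\Delta h=0$. For a compatible diagram, $\varphi(z)=(h\Delta)z$ is a trivialization of $\Delta$, and it defines, by the formula of Khoroshkin, Markarian and Shadrin, the hypercommutative operations $\theta_n$ ($n\ge2$, of degree $4-2n$) on $A$, which are finite combinations of compositions of the product with $n-2$ copies of $\varphi=h\Delta$, with $\theta_2(x,y)=x\cdot y$. Explicitly, $\theta_n$ is the sum over all rooted trees with $n$ labelled leaves and all vertices having at least two inputs, with Koszul signs, of the composites in which a formal class $\psi$ is attached to each half-edge, each leaf and the root carry $\exp(\varphi\psi)$, each internal edge with classes $\psi',\psi''$ at its ends carries $\big(1-\exp(\varphi(\psi'+\psi''))\big)/(\psi'+\psi'')$, and each vertex with $k$ inputs carries the $k$-fold product, the monomial $\psi_0^{a_0}\cdots\psi_k^{a_k}$ at that vertex being replaced by $(k-2)!/(a_0!\cdots a_k!)$ if $a_0+\cdots+a_k=k-2$ and by $0$ otherwise. Then: 1. $(A,d,\cdot,\Delta)$ is formal as a $\mathrm{BV}$-algebra: it is connected by a zigzag of quasi-isomorphisms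 of $\mathrm{BV}$-algebras with a $\mathrm{BV}$-algebra whose differential is zero. 2. The induced $\mathrm{Hycom}_\infty$-structure on $H$ is trivial. Precisely: * There is a compatible homotopy transfer diagram with $\rho(z)=[z]$ for every cocycle $z$ and $h\iota=0$, $\rho h=0$, $h^2=0$. * For every compatible diagram, the hypercommutative structure $(\theta_n)$ on $A$ is homotopically trivial: there are quasi-isomorphisms $A\leftarrow B\to C$ of complexes, compatible with all the operations of arity $n\geq 2$, where $B$ and $C$ are hypercommutative algebras and $C$ has zero differential and $m_n=0$ for all $n\ge3$. * For every compatible diagram with $h\iota=0$, the operations on $H$ obtained by homotopy transfer (the composites along trees of the $\theta_k$, with $\iota$ at the leaves, $h$ at the internal edges and $\rho$ at the root) form a $\mathrm{Hycom}_\infty$-structure on $H$, that is, a codifferential on the cofree coalgebra on $H$ over the Koszul dual cooperad of the operad $\mathrm{Hycom}$ of hypercommutative algebras; and all of them vanish except for the binary product $\mu$, which is the product induced by $A$ on cohomology, in the sense that $\iota(x)\cdot\iota(y)-\iota(\mu(x,y))\in\mathrm{Im}(d)$ for all $x,y\in H$. -/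

import Mathlib

universe u v

open scoped BigOperators

noncomputable section

namespace BVHycom

/-- The Koszul sign `(-1)^p` as a scalar. -/
def sgn (K : Type u) [Field K] (p : ℤ) : K := (-1 : K) ^ p

/-! ### Cochain complexes -/

/-- A cochain complex of `K`-vector spaces, in internal form: a vector space which is the direct sum
of its homogeneous parts `deg n`, `n : ℤ`, with a differential of degree `+1`. -/
structure GradedCx (K : Type u) [Field K] where
  carrier : Type v
  [addCommGroup : AddCommGroup carrier]
  [module : Module K carrier]
  deg : ℤ → Submodule K carrier
  internal : DirectSum.IsInternal deg
  d : carrier →ₗ[K] carrier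
  d_deg : ∀ n x, x ∈ deg n → d x ∈ deg (n + 1)
  d_d : ∀ x, d (d x) = 0

attribute [instance] GradedCx.addCommGroup GradedCx.module

/-- A morphism of cochain complexes. -/
structure CxHom {K : Type u} [Field K] (X Y : GradedCx.{u, v} K) where
  toLin : X.carrier →ₗ[K] Y.carrier
  map_deg : ∀ n x, x ∈ X.deg n → toLin x ∈ Y.deg n
  map_d : ∀ x, toLin (X.d x) = Y.d (toLin x)

/-- A morphism of complexes is a quasi-isomorphism when the map that it induces on cohomology is
injective and surjective. -/
def CxHom.IsQuasiIso {K : Type u} [Field K] {X Y : GradedCx.{u, v} K} (f : CxHom X Y) : Prop :=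
  (∀ x, X.d x = 0 → f.toLin x ∈ LinearMap.range Y.d → x ∈ LinearMap.range X.d) ∧
  (∀ y, Y.d y = 0 → ∃ x, X.d x = 0 ∧ y - f.toLin x ∈ LinearMap.range Y.d)

/-- The cohomology `Ker d / Im d`. -/
abbrev GradedCx.Coh {K : Type u} [Field K] (X : GradedCx.{u, v} K) : Type v :=
  ↥(LinearMap.ker X.d) ⧸ (LinearMap.range X.d).comap (LinearMap.ker X.d).subtype

/-- The part of degree `n` of the cohomology: the classes of the cocycles of degree `n`. -/
def GradedCx.cohDeg {K : Type u} [Field K] (X : GradedCx.{u, v} K) (n : ℤ) :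
    Submodule K X.Coh :=
  ((X.deg n).comap (LinearMap.ker X.d).subtype).map (Submodule.mkQ _)

/-! ### Batalin-Vilkovisky algebras -/

/-- The bracket `[x, y] = (-1)^p (Δ(xy) - Δ(x) y - (-1)^p x Δ(y))`, for `x` of degree `p`. -/
def bvBracket {K : Type u} [Field K] {V : Type v} [AddCommGroup V] [Module K V]
    (mul : V →ₗ[K] V →ₗ[K] V) (Δ : V →ₗ[K] V) (p : ℤ) (x y : V) : V :=
  sgn K p • (Δ (mul x y) - mul (Δ x) y - sgn K p • mul x (Δ y))

/-- A (differential graded, not necessarily unital) Batalin-Vilkovisky algebra. -/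
structure BVAlgebra (K : Type u) [Field K] extends GradedCx.{u, v} K where
  mul : carrier →ₗ[K] carrier →ₗ[K] carrier
  Δ : carrier →ₗ[K] carrier
  mul_deg : ∀ p q x y, x ∈ deg p → y ∈ deg q → mul x y ∈ deg (p + q)
  Δ_deg : ∀ n x, x ∈ deg n → Δ x ∈ deg (n - 1)
  Δ_Δ : ∀ x, Δ (Δ x) = 0
  d_Δ : ∀ x, d (Δ x) + Δ (d x) = 0
  mul_assoc : ∀ x y z, mul (mul x y) z = mul x (mul y z)
  mul_comm : ∀ p q x y, x ∈ deg p → y ∈ deg q → mul x y = sgn K (p * q) • mul y x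
  d_mul : ∀ p x y, x ∈ deg p → d (mul x y) = mul (d x) y + sgn K p • mul x (d y)
  bracket_mul : ∀ p q x y z, x ∈ deg p → y ∈ deg q →
    bvBracket mul Δ p x (mul y z) =
      mul (bvBracket mul Δ p x y) z + sgn K ((p - 1) * q) • mul y (bvBracket mul Δ p x z)

/-- A morphism of BV-algebras. -/
structure BVHom {K : Type u} [Field K] (A B : BVAlgebra.{u, v} K) extends
    CxHom A.toGradedCx B.toGradedCx where
  map_mul : ∀ x y, toLin (A.mul x y) = B.mul (toLin x) (toLin y)
  map_Δ : ∀ x, toLin (A.Δ x) = B.Δ (toLin x)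

namespace BVAlgebra

variable {K : Type u} [Field K]

/-- A `BV₁`-algebra: the operator `Δ` is a derivation (of degree `-1`). -/
def IsBV1 (A : BVAlgebra.{u, v} K) : Prop :=
  ∀ p x y, x ∈ A.deg p → A.Δ (A.mul x y) = A.mul (A.Δ x) y + sgn K p • A.mul x (A.Δ y)

/-- `Ker d ∩ Im Δ = Ker Δ ∩ Im d = Im (dΔ)`. -/
def DDeltaCondition (A : BVAlgebra.{u, v} K) : Prop :=
  LinearMap.ker A.d ⊓ LinearMap.range A.Δ = LinearMap.ker A.Δ ⊓ LinearMap.range A.d ∧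
  LinearMap.ker A.Δ ⊓ LinearMap.range A.d = LinearMap.range (A.d ∘ₗ A.Δ)

/-- A BV-algebra is formal when it is connected, by a zigzag of quasi-isomorphisms of BV-algebras,
with a BV-algebra whose differential is zero. -/
def IsFormal (A : BVAlgebra.{u, v} K) : Prop :=
  ∃ B : BVAlgebra.{u, v} K, B.d = 0 ∧
    Relation.EqvGen
      (fun X Y : BVAlgebra.{u, v} K => ∃ f : BVHom X Y, f.toCxHom.IsQuasiIso) A B

end BVAlgebra

/-- A homotopy transfer diagram between `(X, d)` and its cohomology `(H, 0)`. -/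
structure HTDiagram {K : Type u} [Field K] (X : GradedCx.{u, v} K) where
  ι : X.Coh →ₗ[K] X.carrier
  ρ : X.carrier →ₗ[K] X.Coh
  h : X.carrier →ₗ[K] X.carrier
  ι_deg : ∀ n x, x ∈ X.cohDeg n → ι x ∈ X.deg n
  ρ_deg : ∀ n x, x ∈ X.deg n → ρ x ∈ X.cohDeg n
  h_deg : ∀ n x, x ∈ X.deg n → h x ∈ X.deg (n - 1)
  d_ι : ∀ x, X.d (ι x) = 0
  ρ_d : ∀ x, ρ (X.d x) = 0
  ρ_ι : ∀ x, ρ (ι x) = x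
  homotopy : ∀ x, X.d (h x) + h (X.d x) = x - ι (ρ x)

/-- `Δ ι = 0`, `ρ Δ = 0` and `h Δ + Δ h = 0`. -/
def HTDiagram.Compatible {K : Type u} [Field K] (A : BVAlgebra.{u, v} K)
    (D : HTDiagram A.toGradedCx) : Prop :=
  (∀ x, A.Δ (D.ι x) = 0) ∧ (∀ x, D.ρ (A.Δ x) = 0) ∧ (∀ x, D.h (A.Δ x) + A.Δ (D.h x) = 0)

/-! ### Trees -/

mutual
/-- Planar rooted trees all of whose vertices have at least two inputs, with leaves decorated by
elements of `α`. -/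
inductive RTree (α : Type v) : Type v
  | leaf (a : α) : RTree α
  | node (f : RForest α) : RTree α
/-- Lists, of length at least two, of such trees. -/
inductive RForest (α : Type v) : Type v
  | pair (t s : RTree α) : RForest α
  | cons (t : RTree α) (f : RForest α) : RForest α
end

mutual
/-- Change the decorations of the leaves. -/
def RTree.map {α : Type u} {β : Type v} (g : α → β) : RTree α → RTree β
  | .leaf a => .leaf (g a)
  | .node f => .node (f.map g)
/-- Change the decorations of the leaves. -/
def RForest.map {α : Type u} {β : Type v} (g : α → β) : RForest α → RForest β
  | .pair t s => .pair (t.map g) (s.map g)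
  | .cons t f => .cons (t.map g) (f.map g)
end

/-- The number of trees in the forest. -/
def RForest.length {α : Type v} : RForest α → ℕ
  | .pair _ _ => 2
  | .cons _ f => f.length + 1

mutual
/-- The vertices (written `none`) and the decorations of the leaves, in depth-first order from the
root, from left to right. -/
def RTree.word {α : Type v} : RTree α → List (Option α)
  | .leaf a => [some a]
  | .node f => none :: f.word
/-- The concatenation of the words of the trees. -/
def RForest.word {α : Type v} : RForest α → List (Option α)
  | .pair t s => t.word ++ s.word
  | .cons t f => t.word ++ f.word
end

/-- The decorations of the leaves, from left to right. -/
def RTree.leaves {α : Type v} (T : RTree α) : List α := T.word.filterMap id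

/-- The leaves are decorated bijectively by `Fin n`. -/
def RTree.Labelled {n : ℕ} (T : RTree (Fin n)) : Prop := T.leaves.Perm (List.finRange n)

mutual
/-- A tree has fewer vertices than leaves. -/
theorem RTree.word_length_le {α : Type v} : (T : RTree α) →
    T.word.length + 1 ≤ 2 * (T.word.filterMap id).length
  | .leaf a => by simp [RTree.word]
  | .node f => by
      have := RForest.word_length_le f
      simp only [RTree.word, List.length_cons, List.filterMap_cons, id]
      simp only [id_def] at this ⊢
      omega
/-- The analogous bound for forests. -/
theorem RForest.word_length_le {α : Type v} : (f : RForest α) →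
    f.word.length + 2 ≤ 2 * (f.word.filterMap id).length
  | .pair t s => by
      have := RTree.word_length_le t
      have := RTree.word_length_le s
      simp only [RForest.word, List.length_append, List.filterMap_append]
      omega
  | .cons t f => by
      have := RTree.word_length_le t
      have := RForest.word_length_le f
      simp only [RForest.word, List.length_append, List.filterMap_append]
      omega
end

theorem RTree.finite_word_length_le {α : Type v} [Finite α] (N : ℕ) :
    {T : RTree α | T.word.length ≤ N}.Finite ∧ {f : RForest α | f.word.length ≤ N}.Finite := by
  induction N with
  | zero =>
    constructor
    · refine Set.finite_empty.subset ?_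
      rintro (a | f) hT <;> simp [RTree.word] at hT
    · refine Set.finite_empty.subset ?_
      rintro f hf
      have h1 := RForest.word_length_le f
      have h2 := List.length_filterMap_le id f.word
      simp only [Set.mem_ofPred_eq] at hf
      omega
  | succ N ih =>
    have pos : ∀ t : RTree α, 1 ≤ t.word.length := by
      rintro (a | f) <;> simp [RTree.word]
    have pos' : ∀ f : RForest α, 1 ≤ f.word.length := by
      intro f
      have h1 := RForest.word_length_le f
      have h2 := List.length_filterMap_le id f.word
      omega
    constructor
    · refine ((Set.finite_range RTree.leaf).union (ih.2.image RTree.node)).subset ?_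
      rintro (a | f) hT
      · exact Or.inl ⟨a, rfl⟩
      · refine Or.inr ⟨f, ?_, rfl⟩
        simpa [RTree.word] using hT
    · refine ((ih.1.image2 RForest.pair ih.1).union (ih.1.image2 RForest.cons ih.2)).subset ?_
      rintro (⟨t, s⟩ | ⟨t, f⟩) hf <;>
        simp only [RForest.word, List.length_append, Set.mem_ofPred_eq] at hf
      · have h1 := pos t
        have h2 := pos s
        exact Or.inl ⟨t, by simp only [Set.mem_ofPred_eq]; omega, s,
          by simp only [Set.mem_ofPred_eq]; omega, rfl⟩
      · have h1 := pos t
        have h2 := pos' f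
        exact Or.inr ⟨t, by simp only [Set.mem_ofPred_eq]; omega, f,
          by simp only [Set.mem_ofPred_eq]; omega, rfl⟩

/-- There are finitely many labelled trees with `n` leaves, so that the sums over them below are
finite sums. -/
theorem RTree.finite_labelled (n : ℕ) : {T : RTree (Fin n) | T.Labelled}.Finite := by
  refine (RTree.finite_word_length_le (2 * n)).1.subset ?_
  intro T hT
  have h1 := RTree.word_length_le T
  have h2 : (T.word.filterMap id).length = n := by
    have := List.Perm.length_eq hT
    simpa [RTree.leaves] using this
  simp only [Set.mem_ofPred_eq]
  omega

/-- Exponent of the Koszul sign of the permutation which takes the word consisting of all the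
symbols `none` followed by the labels in increasing order to the given word; the symbols `none` are
odd and keep their order, and the label `a` has degree `e a`. -/
def wordSign {n : ℕ} (e : Fin n → ℤ) : List (Option (Fin n)) → ℤ
  | [] => 0
  | none :: w => wordSign e w
  | some a :: w =>
      e a * (w.count none : ℤ) +
        (((w.filterMap id).filter (fun b => b < a)).map (fun b => e a * e b)).sum + wordSign e w

/-- Exponent of the Koszul sign of rearranging elements of degrees `e` in the order of the list. -/
def listSign {n : ℕ} (e : Fin n → ℤ) (l : List (Fin n)) : ℤ := wordSign e (l.map some)

/-! ### Hypercommutative algebras -/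

/-- A family of operations, one in each arity, applied to a list. -/
def applyList {K : Type u} [Field K] {V : Type v} [AddCommGroup V] [Module K V]
    (m : (n : ℕ) → MultilinearMap K (fun _ : Fin n => V) V) (l : List V) : V :=
  m l.length l.get

/-- The sum over the decompositions `{3, …, n+2} = S₁ ⊔ S₂` of
`± m(m(y₀, y₁, y_{S₁}), y₂, y_{S₂})`, with Koszul signs. -/
def hycomLeft {K : Type u} [Field K] {V : Type v} [AddCommGroup V] [Module K V]
    (m : (n : ℕ) → MultilinearMap K (fun _ : Fin n => V) V) {n : ℕ}
    (e : Fin (n + 3) → ℤ) (y : Fin (n + 3) → V) : V :=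
  ∑ S ∈ (Finset.univ.filter (fun i : Fin (n + 3) => 2 < i)).powerset,
    sgn K (listSign e (0 :: 1 :: S.sort (· ≤ ·) ++
        2 :: ((Finset.univ.filter (fun i : Fin (n + 3) => 2 < i)) \ S).sort (· ≤ ·))) •
      applyList m (applyList m (y 0 :: y 1 :: (S.sort (· ≤ ·)).map y) :: y 2 ::
        (((Finset.univ.filter (fun i : Fin (n + 3) => 2 < i)) \ S).sort (· ≤ ·)).map y)

/-- The sum over the decompositions `{3, …, n+2} = S₁ ⊔ S₂` of
`± m(y₀, m(y₁, y₂, y_{S₁}), y_{S₂})`, with Koszul signs. -/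
def hycomRight {K : Type u} [Field K] {V : Type v} [AddCommGroup V] [Module K V]
    (m : (n : ℕ) → MultilinearMap K (fun _ : Fin n => V) V) {n : ℕ}
    (e : Fin (n + 3) → ℤ) (y : Fin (n + 3) → V) : V :=
  ∑ S ∈ (Finset.univ.filter (fun i : Fin (n + 3) => 2 < i)).powerset,
    sgn K (listSign e (0 :: 1 :: 2 :: S.sort (· ≤ ·) ++
        ((Finset.univ.filter (fun i : Fin (n + 3) => 2 < i)) \ S).sort (· ≤ ·))) •
      applyList m (y 0 :: applyList m (y 1 :: y 2 :: (S.sort (· ≤ ·)).map y) ::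
        (((Finset.univ.filter (fun i : Fin (n + 3) => 2 < i)) \ S).sort (· ≤ ·)).map y)

/-- A hypercommutative algebra: graded symmetric operations `m n` of degree `2 (2 - n)`, for
`n ≥ 2`, which commute with the differential and satisfy the generalized associativity relations.
The operations `m 0` and `m 1` are not part of the structure and are never used. -/
structure HycomAlgebra (K : Type u) [Field K] extends GradedCx.{u, v} K where
  m : (n : ℕ) → MultilinearMap K (fun _ : Fin n => carrier) carrier
  m_deg : ∀ n, 2 ≤ n → ∀ (e : Fin n → ℤ) (x : Fin n → carrier), (∀ i, x i ∈ deg (e i)) →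
    m n x ∈ deg (∑ i, e i + 2 * (2 - (n : ℤ)))
  m_symm : ∀ n, 2 ≤ n → ∀ (e : Fin n → ℤ) (x : Fin n → carrier), (∀ i, x i ∈ deg (e i)) →
    ∀ σ : Equiv.Perm (Fin n),
      m n (fun i => x (σ i)) = sgn K (listSign e (List.ofFn σ)) • m n x
  d_m : ∀ n, 2 ≤ n → ∀ (e : Fin n → ℤ) (x : Fin n → carrier), (∀ i, x i ∈ deg (e i)) →
    d (m n x) = ∑ i, sgn K (∑ j ∈ Finset.univ.filter (fun j => j < i), e j) •
      m n (Function.update x i (d (x i)))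
  assoc : ∀ (n : ℕ) (e : Fin (n + 3) → ℤ) (y : Fin (n + 3) → carrier),
    (∀ i, y i ∈ deg (e i)) → hycomLeft m e y = hycomRight m e y

/-- A morphism of hypercommutative algebras. -/
structure HycomHom {K : Type u} [Field K] (B C : HycomAlgebra.{u, v} K) extends
    CxHom B.toGradedCx C.toGradedCx where
  map_m : ∀ n, 2 ≤ n → ∀ x : Fin n → B.carrier,
    toLin (B.m n x) = C.m n (fun i => toLin (x i))

/-- A hypercommutative algebra is trivial when it is a commutative algebra with zero differential,
without operations in the arities `n ≥ 3`. -/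
def HycomAlgebra.IsTrivial {K : Type u} [Field K] (C : HycomAlgebra.{u, v} K) : Prop :=
  C.d = 0 ∧ ∀ n, 3 ≤ n → C.m n = 0

/-! ### The hypercommutative operations of a BV-algebra with a trivialization of `Δ`

The operation `θ_n` is the integral over `\overline{M}_{0,n+1}` of the classes obtained by the
action of `R(z) = exp(φ z)` on the commutative product: a sum over the trees `T` with `n` leaves,
where `ψ`-classes are attached to all half-edges; the leaves and the root carry `exp(φ ψ)`, an
internal edge with classes `ψ'`, `ψ''` at its ends carries
`(1 - exp(φ (ψ' + ψ''))) / (ψ' + ψ'')`, and a vertex with `k` inputs carries the `k`-fold product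
together with the integral of the `ψ`-classes attached to its half-edges, namely
`(k-2)! / (a_0! ⋯ a_k!)` for `ψ_0^{a_0} ⋯ ψ_k^{a_k}` with `a_0 + ⋯ + a_k = k - 2`. -/

section theta

variable {K : Type u} [Field K] {V : Type v} [AddCommGroup V] [Module K V]

/-- The number `(k-2)! / k!` (the factor `1/k!` compensates for the number of orders of the
inputs of a vertex). -/
def vertexCoeff (K : Type u) [Field K] (k : ℕ) : K :=
  ((k - 2).factorial : K) / (k.factorial : K)

mutual
/-- The contribution of a branch to the vertex on which it sits, when the half-edge at that vertex
carries `ψ^a`. -/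
def branchValue (mul : V →ₗ[K] V →ₗ[K] V) (φ : V →ₗ[K] V) : RTree V → ℕ → V
  | .leaf x, a => ((a.factorial : K))⁻¹ • (φ ^ a) x
  | .node f, a =>
      -∑ p ∈ Finset.HasAntidiagonal.antidiagonal (f.length - 2),
        (vertexCoeff K f.length /
          ((p.1.factorial : K) * ((p.1 + a + 1 : ℕ) : K) *
            (p.1.factorial : K) * (a.factorial : K))) •
          (φ ^ (p.1 + a + 1)) (inputsValue mul φ f p.2)
/-- The product of the contributions of the branches, summed over all ways to distribute the
exponent `b` over the half-edges of the branches. -/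
def inputsValue (mul : V →ₗ[K] V →ₗ[K] V) (φ : V →ₗ[K] V) : RForest V → ℕ → V
  | .pair t s, b => ∑ p ∈ Finset.HasAntidiagonal.antidiagonal b,
      mul (((p.1.factorial : K))⁻¹ • branchValue mul φ t p.1)
        (((p.2.factorial : K))⁻¹ • branchValue mul φ s p.2)
  | .cons t f, b => ∑ p ∈ Finset.HasAntidiagonal.antidiagonal b,
      mul (((p.1.factorial : K))⁻¹ • branchValue mul φ t p.1) (inputsValue mul φ f p.2)
end

/-- The contribution of a tree with at least one vertex. -/
def treeValue (mul : V →ₗ[K] V →ₗ[K] V) (φ : V →ₗ[K] V) : RTree V → V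
  | .leaf _ => 0
  | .node f =>
      ∑ p ∈ Finset.HasAntidiagonal.antidiagonal (f.length - 2),
        (vertexCoeff K f.length / ((p.1.factorial : K) * (p.1.factorial : K))) •
          (φ ^ p.1) (inputsValue mul φ f p.2)

/-- The operation `θ_n(x_1, …, x_n)` on homogeneous elements, `x i` of degree `e i`, for an operator
`φ` of even degree. The sum runs over the planar trees with leaves labelled by `Fin n` (there are
finitely many); a tree that is not planar is counted once for each of its planar representatives,
which is made up for by the factors `1/k!`. -/
def theta (mul : V →ₗ[K] V →ₗ[K] V) (φ : V →ₗ[K] V) (n : ℕ) (e : Fin n → ℤ) (x : Fin n → V) : V :=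
  ∑ᶠ (T : RTree (Fin n)) (_ : T.Labelled),
    sgn K (listSign e T.leaves) • treeValue mul φ (T.map x)

/-- `θ_n` for a list of homogeneous elements, given with their degrees. -/
def thetaList (mul : V →ₗ[K] V →ₗ[K] V) (φ : V →ₗ[K] V) (l : List (ℤ × V)) : V :=
  theta mul φ l.length (fun i => (l.get i).1) (fun i => (l.get i).2)

end theta

/-- The hypercommutative structure on `A` given by the trivialization `φ(z) = (h Δ) z` is
homotopically trivial: there are a hypercommutative algebra `B`, a trivial one `C`, and
quasi-isomorphisms `A ← B → C` compatible with all the operations. -/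
def HycomHomotopicallyTrivial {K : Type u} [Field K] (A : BVAlgebra.{u, v} K)
    (D : HTDiagram A.toGradedCx) : Prop :=
  ∃ (B C : HycomAlgebra.{u, v} K) (f : CxHom B.toGradedCx A.toGradedCx) (g : HycomHom B C),
    C.IsTrivial ∧ f.IsQuasiIso ∧ g.toCxHom.IsQuasiIso ∧
    ∀ n, 2 ≤ n → ∀ (e : Fin n → ℤ) (x : Fin n → B.carrier), (∀ i, x i ∈ B.deg (e i)) →
      f.toLin (B.m n x) = theta A.mul (D.h ∘ₗ A.Δ) n e (fun i => f.toLin (x i))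

/-! ### `Hycom_∞`-structures

The operad of hypercommutative algebras is quadratic, generated by `E = ⟨m_n, n ≥ 2⟩`, with the
relations `R` of generalized associativity. Its Koszul dual cooperad `Hycom^¡` is the quadratic
cooperad with cogenerators `sE` and corelations `s²R`, inside the cofree cooperad `T^c(sE)`. -/

section koszul

mutual
/-- The vertices, in depth-first order from the root, each given by the set of the leaves above
it. -/
def RTree.vertices {n : ℕ} : RTree (Fin n) → List (Finset (Fin n))
  | .leaf _ => []
  | .node f => (RTree.node f).leaves.toFinset :: f.vertices
/-- The vertices of the trees of a forest. -/
def RForest.vertices {n : ℕ} : RForest (Fin n) → List (Finset (Fin n))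
  | .pair t s => t.vertices ++ s.vertices
  | .cons t f => t.vertices ++ f.vertices
end

mutual
/-- The vertices, in depth-first order from the root, each given by the list of its branches. -/
def RTree.forests {α : Type v} : RTree α → List (RForest α)
  | .leaf _ => []
  | .node f => f :: f.forests
/-- The vertices of the trees of a forest, each given by the list of its branches. -/
def RForest.forests {α : Type v} : RForest α → List (RForest α)
  | .pair t s => t.forests ++ s.forests
  | .cons t f => t.forests ++ f.forests
end

/-- The sets of leaves of the branches. -/
def RForest.blocks {n : ℕ} : RForest (Fin n) → Finset (Finset (Fin n))
  | .pair t s => {t.leaves.toFinset, s.leaves.toFinset}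
  | .cons t f => insert t.leaves.toFinset f.blocks

variable (K : Type u) [Field K]

/-- The elements of `T^c(sE)(n)` are represented by formal linear combinations of labelled planar
trees. The generators `s m_k` are odd and symmetric, so a tree is determined by its set of vertices
(as sets of leaves) together with an order of the vertices up to even permutations: the class of a
tree is the product of its vertices in an exterior algebra. -/
def treeClass {n : ℕ} (T : RTree (Fin n)) : ExteriorAlgebra K (Finset (Fin n) →₀ K) :=
  (T.vertices.map (fun U => ExteriorAlgebra.ι K (Finsupp.single U (1 : K)))).prod

variable {K}

/-- The element of `T^c(sE)(n)` represented by a linear combination of trees. -/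
def combClass {n : ℕ} (z : RTree (Fin n) →₀ K) : ExteriorAlgebra K (Finset (Fin n) →₀ K) :=
  z.sum (fun T c => c • treeClass K T)

/-- The sets of branches which can be grouped, to split a vertex into two vertices. -/
def RForest.splits {n : ℕ} (f : RForest (Fin n)) : Finset (Finset (Finset (Fin n))) :=
  f.blocks.powerset.filter (fun S => 2 ≤ S.card ∧ S.card < f.blocks.card)

variable (K)

/-- The sum of the new vertices for all splittings of a vertex which group `a` and `b`
but not `c`. -/
def splitSum {n : ℕ} (f : RForest (Fin n)) (a b c : Finset (Fin n)) :
    ExteriorAlgebra K (Finset (Fin n) →₀ K) :=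
  ∑ S ∈ f.splits.filter (fun S => a ∈ S ∧ b ∈ S ∧ c ∉ S),
    ExteriorAlgebra.ι K (Finsupp.single (S.sup id) (1 : K))

/-- The elements obtained from the tree `T` by splitting the vertex `f` in two according to a
relation of generalized associativity. -/
def localRelations {n : ℕ} (T : RTree (Fin n)) (f : RForest (Fin n)) :
    Submodule K (ExteriorAlgebra K (Finset (Fin n) →₀ K)) :=
  Submodule.span K {r | ∃ a ∈ f.blocks, ∃ b ∈ f.blocks, ∃ c ∈ f.blocks,
    a ≠ b ∧ b ≠ c ∧ a ≠ c ∧ r = treeClass K T * (splitSum K f a b c - splitSum K f b c a)}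

/-- The span of the trees which are not obtained from `T` by splitting the vertex `f`. -/
def otherTrees {n : ℕ} (T : RTree (Fin n)) (f : RForest (Fin n)) :
    Submodule K (ExteriorAlgebra K (Finset (Fin n) →₀ K)) :=
  Submodule.span K {r | ∃ T' : RTree (Fin n), T'.Labelled ∧
    (∀ S ∈ f.splits, T'.vertices.toFinset ≠ insert (S.sup id) T.vertices.toFinset) ∧
    r = treeClass K T'}

variable {K}

/-- The linear combination of trees represents an element of `T^c(sE)(n)`. -/
def IsTreeComb {n : ℕ} (z : RTree (Fin n) →₀ K) : Prop := ∀ T ∈ z.support, T.Labelled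

/-- The linear combination of trees represents an element of the Koszul dual cooperad
`Hycom^¡(n) ⊆ T^c(sE)(n)`: at each internal edge (that is, in the components where a vertex of some
tree is split in two) it is given by elements of `s²R`. -/
def IsKoszulDual {n : ℕ} (z : RTree (Fin n) →₀ K) : Prop :=
  IsTreeComb z ∧ ∀ T : RTree (Fin n), T.Labelled → ∀ f ∈ T.forests,
    combClass z ∈ localRelations K T f ⊔ otherTrees K T f

end koszul

section infinity

variable {K : Type u} [Field K] {H : Type v} [AddCommGroup H] [Module K H]

mutual
/-- The degree of a tree with leaves decorated by elements with given degrees; a vertex `s m_k` has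
degree `3 - 2k`. -/
def RTree.degree : RTree (ℤ × H) → ℤ
  | .leaf p => p.1
  | .node f => (3 - 2 * (f.length : ℤ)) + f.degree
/-- The sum of the degrees. -/
def RForest.degree : RForest (ℤ × H) → ℤ
  | .pair t s => t.degree + s.degree
  | .cons t f => t.degree + f.degree
end

/-- The decorations of the leaves are homogeneous elements with their degrees. -/
def RTree.Homogeneous (deg : ℤ → Submodule K H) (T : RTree (ℤ × H)) : Prop :=
  ∀ p ∈ T.leaves, p.2 ∈ deg p.1

mutual
/-- The terms of the coderivation of degree one with corestriction `op`: a subtree (starting at a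
vertex) is replaced by a leaf decorated by the value of `op` at that subtree. Each term is given with
the exponent of its sign, the degree of the part of the word before the subtree. -/
def RTree.cuts (op : RTree (ℤ × H) → H) : RTree (ℤ × H) → List (ℤ × RTree (ℤ × H))
  | .leaf _ => []
  | .node f =>
      (0, .leaf ((RTree.node f).degree + 1, op (.node f))) ::
        (f.cuts op).map (fun q => (q.1 + 1, .node q.2))
/-- The same for the trees of a forest. -/
def RForest.cuts (op : RTree (ℤ × H) → H) : RForest (ℤ × H) → List (ℤ × RForest (ℤ × H))
  | .pair t s =>
      (t.cuts op).map (fun q => (q.1, .pair q.2 s)) ++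
        (s.cuts op).map (fun q => (q.1 + t.degree, .pair t q.2))
  | .cons t f =>
      (t.cuts op).map (fun q => (q.1, .cons q.2 f)) ++
        (f.cuts op).map (fun q => (q.1 + t.degree, .cons t q.2))
end

/-- The corestriction of the square of the coderivation defined by `op`. -/
def cutSquare (K : Type u) [Field K] {H : Type v} [AddCommGroup H] [Module K H] (op : RTree (ℤ × H) → H) (T : RTree (ℤ × H)) : H :=
  ((T.cuts op).map (fun q => sgn K q.1 • op q.2)).sum

/-- The value of a function of decorated trees at `z ⊗ x_1 ⊗ ⋯ ⊗ x_n`, where `z` is a combination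
of labelled trees and `x i` has degree `e i`. -/
def evalComb (g : RTree (ℤ × H) → H) {n : ℕ} (z : RTree (Fin n) →₀ K) (e : Fin n → ℤ)
    (x : Fin n → H) : H :=
  z.sum (fun T c => (c * sgn K (wordSign e T.word)) • g (T.map (fun i => (e i, x i))))

/-- `Hycom_∞`-structures on a graded vector space `H` (with zero differential), as codifferentials
on the cofree `Hycom^¡`-coalgebra on `H`, or equivalently as twisting morphisms from `Hycom^¡` to
the endomorphism operad of `H`. A coderivation is given by its corestriction
`op : Hycom^¡(H) → H`, of degree one, which is written here as the restriction of a map that is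
defined on all trees with leaves decorated by (homogeneous) elements of `H`. -/
structure IsHycomInfty (deg : ℤ → Submodule K H) (op : RTree (ℤ × H) → H) : Prop where
  op_leaf : ∀ p, op (.leaf p) = 0
  op_deg : ∀ T, T.Homogeneous deg → op T ∈ deg (T.degree + 1)
  op_linear : ∀ (n : ℕ) (T : RTree (Fin n)), T.Labelled → ∀ e : Fin n → ℤ,
    ∃ M : MultilinearMap K (fun _ : Fin n => H) H, ∀ x : Fin n → H, (∀ i, x i ∈ deg (e i)) →
      op (T.map (fun i => (e i, x i))) = M x
  op_class : ∀ (n : ℕ) (z : RTree (Fin n) →₀ K), IsTreeComb z → combClass z = 0 →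
    ∀ (e : Fin n → ℤ) (x : Fin n → H), (∀ i, x i ∈ deg (e i)) → evalComb op z e x = 0
  square_zero : ∀ (n : ℕ) (z : RTree (Fin n) →₀ K), IsKoszulDual z →
    ∀ (e : Fin n → ℤ) (x : Fin n → H), (∀ i, x i ∈ deg (e i)) →
      evalComb (cutSquare K op) z e x = 0

/-- The structure given by a product and no other operation. -/
def productOp (μ : H →ₗ[K] H →ₗ[K] H) : RTree (ℤ × H) → H
  | .node (.pair (.leaf p) (.leaf q)) => μ p.2 q.2
  | _ => 0

end infinity

section transfer

variable {K : Type u} [Field K] (A : BVAlgebra.{u, v} K) (D : HTDiagram A.toGradedCx)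

mutual
/-- The composite along a tree of the operations `θ_k` of `A`, with `ι` at the leaves and `h` after
each operation, together with its degree. -/
def transferTree : RTree (ℤ × A.Coh) → ℤ × A.carrier
  | .leaf p => (p.1, D.ι p.2)
  | .node f =>
      let l := transferForest f
      ((l.map Prod.fst).sum + (3 - 2 * (l.length : ℤ)),
        D.h (thetaList A.mul (D.h ∘ₗ A.Δ) l))
/-- The same for the trees of a forest. -/
def transferForest : RForest (ℤ × A.Coh) → List (ℤ × A.carrier)
  | .pair t s => [transferTree t, transferTree s]
  | .cons t f => transferTree t :: transferForest f
end

/-- The `Hycom_∞`-structure induced on the cohomology, by homotopy transfer, by the hypercommutative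
structure `θ` on `A` that the trivialization `φ(z) = (h Δ) z` defines: the composites along the trees
of the operations `θ_k`, with `ι` at the leaves, `h` at the internal edges and `ρ` at the root. -/
def transferredOp : RTree (ℤ × A.Coh) → A.Coh
  | .leaf _ => 0
  | .node f => D.ρ (thetaList A.mul (D.h ∘ₗ A.Δ) (transferForest A D f))

end transfer

end BVHycom

end

noncomputable section

namespace BVHycom

-- Everything takes place on the pair `Im Δ ⊆ Ker Δ`. Since `Δ` is a derivation, `Ker Δ` is a dg
-- subalgebra on which the BV operator is zero, and `Im Δ` is an ideal of it. The `dΔ`-condition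
-- yields a contraction `h` of `A` anticommuting with `Δ` (`exists_homotopy`, `exists_compatible`),
-- so `h` preserves both subspaces. Hence `Ker Δ → A` and `ρ : Ker Δ → H` are quasi-isomorphisms.
-- The second is multiplicative because `x - ι ρ x` lies in the ideal `Im Δ`, which `ρ` kills
-- (`sub_ι_ρ_mem_range`). The zigzag `A ← Ker Δ → H` gives formality.
--
-- The operator `φ = h Δ` vanishes on `Ker Δ`. In the formula for `θ_n` every internal edge is
-- divisible by `φ`, so on `Ker Δ` only corollas without `ψ`-classes survive, and the dimension
-- constraint at the vertex leaves `n = 2` (`treeValue_eq_zero`). The same zigzag is therefore one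
-- of hypercommutative algebras.
--
-- For the transferred operations, `h ι = 0` makes `h` send `Ker Δ` into `Im Δ`. A tree with an
-- internal edge then evaluates in the ideal `Im Δ` and dies under `ρ`, and a corolla survives only
-- in arity two (`transferredOp_eq`).
--
-- That the product alone is a `Hycom_∞`-structure is a statement about arity three: the square of
-- the coderivation sees only binary trees with three leaves, each contributing the same triple
-- product up to the sign already built into tree classes, while the coefficients of an element of
-- the Koszul dual on these trees add up to zero (`cutSquare_three`,
-- `IsKoszulDual.binaryCount_eq_zero`).

theorem sgn_add {K : Type u} [Field K] (p q : ℤ) : sgn K (p + q) = sgn K p * sgn K q :=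
  zpow_add₀ (neg_ne_zero.mpr one_ne_zero) p q

theorem sgn_zero {K : Type u} [Field K] : sgn K 0 = 1 := zpow_zero _

theorem sgn_one {K : Type u} [Field K] : sgn K 1 = -1 := zpow_one _

theorem sgn_mul_self {K : Type u} [Field K] (p : ℤ) : sgn K p * sgn K p = 1 := by
  rw [sgn, ← mul_zpow]; simp

theorem sgn_sub_one {K : Type u} [Field K] (p : ℤ) : sgn K (p - 1) = - sgn K p := by
  have h := sgn_add (K := K) (p - 1) 1
  rw [sub_add_cancel, sgn_one] at h
  rw [h]; ring

theorem sgn_add_one {K : Type u} [Field K] (p : ℤ) : sgn K (p + 1) = - sgn K p := by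
  rw [sgn_add, sgn_one]; ring

/-! ### Graded vector spaces -/

/-- A grading is internal as soon as it has projections and spans. -/
theorem isInternal_of_proj {K : Type u} [Field K] {V : Type v} [AddCommGroup V] [Module K V]
    (deg : ℤ → Submodule K V) (proj : ℤ → V →ₗ[K] V)
    (h_self : ∀ n x, x ∈ deg n → proj n x = x)
    (h_ne : ∀ m n x, x ∈ deg m → m ≠ n → proj n x = 0)
    (h_top : ∀ x, x ∈ ⨆ n, deg n) : DirectSum.IsInternal deg := by
  refine (DirectSum.isInternal_submodule_iff_iSupIndep_and_iSup_eq_top deg).2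
    ⟨fun n => ?_, eq_top_iff.2 fun x _ => h_top x⟩
  rw [Submodule.disjoint_def]
  intro x hx hx'
  rw [← h_self n x hx]
  have hle : (⨆ j, ⨆ (_ : j ≠ n), deg j) ≤ LinearMap.ker (proj n) :=
    iSup₂_le fun m hm y hy => h_ne m n y hy hm
  exact hle hx'

namespace GradedCx

variable {K : Type u} [Field K] (X : GradedCx.{u, v} K)

/-- The linear map with given restrictions to the homogeneous parts. -/
def lift {W : Type v} [AddCommGroup W] [Module K W] (f : ∀ n, X.deg n →ₗ[K] W) :
    X.carrier →ₗ[K] W :=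
  DirectSum.toModule K ℤ W f ∘ₗ
    (LinearEquiv.ofBijective (DirectSum.coeLinearMap X.deg) X.internal).symm.toLinearMap

theorem lift_apply {W : Type v} [AddCommGroup W] [Module K W] (f : ∀ n, X.deg n →ₗ[K] W)
    {n : ℤ} {x : X.carrier} (hx : x ∈ X.deg n) : X.lift f x = f n ⟨x, hx⟩ := by
  have h : (LinearEquiv.ofBijective (DirectSum.coeLinearMap X.deg) X.internal).symm x =
      DirectSum.lof K ℤ (fun n => X.deg n) n ⟨x, hx⟩ := by
    rw [LinearEquiv.symm_apply_eq]
    exact (DirectSum.coeLinearMap_lof X.deg n ⟨x, hx⟩).symm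
  rw [lift, LinearMap.comp_apply, LinearEquiv.coe_coe, h, DirectSum.toModule_lof]

theorem mem_iSup_deg (x : X.carrier) : x ∈ ⨆ n, X.deg n := by
  rw [X.internal.submodule_iSup_eq_top]; trivial

/-- A property of elements can be checked on homogeneous ones when it is additive. -/
theorem induction {p : X.carrier → Prop} (h_hom : ∀ n x, x ∈ X.deg n → p x) (h_zero : p 0)
    (h_add : ∀ x y, p x → p y → p (x + y)) (x : X.carrier) : p x :=
  Submodule.iSup_induction X.deg (motive := p) (X.mem_iSup_deg x) h_hom h_zero h_add

/-- The projection to a homogeneous part. -/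
def proj (n : ℤ) : X.carrier →ₗ[K] X.carrier :=
  X.lift fun m => if m = n then (X.deg m).subtype else 0

theorem proj_self {n : ℤ} {x : X.carrier} (hx : x ∈ X.deg n) : X.proj n x = x := by
  simp [proj, X.lift_apply _ hx]

theorem proj_ne {m n : ℤ} {x : X.carrier} (hx : x ∈ X.deg m) (h : m ≠ n) : X.proj n x = 0 := by
  simp [proj, X.lift_apply _ hx, h]

theorem proj_mem (n : ℤ) (x : X.carrier) : X.proj n x ∈ X.deg n := by
  induction x using X.induction with
  | h_hom m x hx =>
    by_cases h : m = n
    · subst h; rwa [X.proj_self hx]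
    · rw [X.proj_ne hx h]; exact zero_mem _
  | h_zero => simp
  | h_add x y hx hy => rw [map_add]; exact add_mem hx hy

/-- Allowing every larger index set `t` makes the property additive: for a sum, take the union of
the two sets. -/
theorem exists_sum_proj (x : X.carrier) :
    ∃ s : Finset ℤ, ∀ t, s ⊆ t → ∑ n ∈ t, X.proj n x = x := by
  classical
  induction x using X.induction with
  | h_hom m x hx =>
    refine ⟨{m}, fun t ht => ?_⟩
    rw [Finset.sum_eq_single_of_mem m (ht (Finset.mem_singleton_self m))
      fun n _ hn => X.proj_ne hx hn.symm, X.proj_self hx]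
  | h_zero => exact ⟨∅, by simp⟩
  | h_add x y hx hy =>
    obtain ⟨s, hs⟩ := hx
    obtain ⟨s', hs'⟩ := hy
    refine ⟨s ∪ s', fun t ht => ?_⟩
    simp only [map_add, Finset.sum_add_distrib]
    rw [hs t (Finset.union_subset_left ht), hs' t (Finset.union_subset_right ht)]

/-- The parity operator. -/
def parity : X.carrier →ₗ[K] X.carrier := X.lift fun n => sgn K n • (X.deg n).subtype

theorem parity_apply {n : ℤ} {x : X.carrier} (hx : x ∈ X.deg n) :
    X.parity x = sgn K n • x := by
  simp [parity, X.lift_apply _ hx]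

theorem parity_parity (x : X.carrier) : X.parity (X.parity x) = x := by
  induction x using X.induction with
  | h_hom m x hx => rw [X.parity_apply hx, map_smul, X.parity_apply hx, smul_smul, sgn_mul_self,
      one_smul]
  | h_zero => simp
  | h_add x y hx hy => simp [hx, hy]

theorem d_parity (x : X.carrier) : X.d (X.parity x) = -X.parity (X.d x) := by
  induction x using X.induction with
  | h_hom n x hx =>
    rw [X.parity_apply hx, X.parity_apply (X.d_deg n x hx), map_smul, sgn_add_one, neg_smul,
      neg_neg]
  | h_zero => simp
  | h_add x x' hx hx' => simp only [map_add, hx, hx']; abel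

/-- Over a field, the restriction of `P` to each degree has a section over its image; this extends
linearly to the whole space, and the sections are glued degree by degree. -/
theorem exists_graded_inverse (P : X.carrier →ₗ[K] X.carrier)
    (hP : ∀ n x, x ∈ X.deg n → P x ∈ X.deg n) :
    ∃ g : X.carrier →ₗ[K] X.carrier, (∀ n x, x ∈ X.deg n → g x ∈ X.deg n) ∧
      ∀ x, P (g (P x)) = P x := by
  have key : ∀ n, ∃ g : X.carrier →ₗ[K] X.deg n, ∀ x ∈ X.deg n, P (g (P x)) = P x := by
    intro n
    obtain ⟨s, hs⟩ := (P ∘ₗ (X.deg n).subtype).rangeRestrict.exists_rightInverse_of_surjective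
      (LinearMap.range_rangeRestrict _)
    obtain ⟨g, hg⟩ := s.exists_extend
    refine ⟨g, fun x hx => ?_⟩
    have h1 := LinearMap.congr_fun hg ((P ∘ₗ (X.deg n).subtype).rangeRestrict ⟨x, hx⟩)
    have h2 := congrArg Subtype.val
      (LinearMap.congr_fun hs ((P ∘ₗ (X.deg n).subtype).rangeRestrict ⟨x, hx⟩))
    simp only [LinearMap.comp_apply, LinearMap.id_apply, Submodule.subtype_apply,
      LinearMap.codRestrict_apply, LinearMap.rangeRestrict] at h1 h2
    rw [h1, h2]
  choose g hg using key
  have hg' : ∀ n x, (hx : x ∈ X.deg n) →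
      X.lift (fun n => (X.deg n).subtype ∘ₗ g n ∘ₗ (X.deg n).subtype) x = g n x := by
    intro n x hx
    rw [X.lift_apply _ hx]; rfl
  refine ⟨X.lift fun n => (X.deg n).subtype ∘ₗ g n ∘ₗ (X.deg n).subtype, fun n x hx => ?_,
    fun x => ?_⟩
  · rw [hg' n x hx]; exact (g n x).2
  · induction x using X.induction with
    | h_hom n x hx => rw [hg' n _ (hP n x hx), hg n x hx]
    | h_zero => simp
    | h_add x y hx hy => simp only [map_add, hx, hy]

end GradedCx

-- Leibniz rules without homogeneity, and the ideal `Im Δ` of `Ker Δ`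

namespace BVAlgebra

variable {K : Type u} [Field K] (A : BVAlgebra.{u, v} K)

theorem Δ_d (x : A.carrier) : A.Δ (A.d x) = -A.d (A.Δ x) :=
  eq_neg_of_add_eq_zero_right (A.d_Δ x)

/-- With the parity operator in place of the sign, the Leibniz rule is linear in `x` and so extends
from homogeneous to arbitrary elements. -/
theorem d_mul_parity (x y : A.carrier) :
    A.d (A.mul x y) = A.mul (A.d x) y + A.mul (A.parity x) (A.d y) := by
  induction x using A.toGradedCx.induction with
  | h_hom n x hx => rw [A.d_mul n x y hx, A.parity_apply hx]; simp
  | h_zero => simp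
  | h_add x x' hx hx' => simp only [map_add, LinearMap.add_apply, hx, hx']; abel

theorem IsBV1.Δ_mul_parity {A : BVAlgebra.{u, v} K} (hA : A.IsBV1) (x y : A.carrier) :
    A.Δ (A.mul x y) = A.mul (A.Δ x) y + A.mul (A.parity x) (A.Δ y) := by
  induction x using A.toGradedCx.induction with
  | h_hom n x hx => rw [hA n x y hx, A.parity_apply hx]; simp
  | h_zero => simp
  | h_add x x' hx hx' => simp only [map_add, LinearMap.add_apply, hx, hx']; abel

theorem Δ_parity (x : A.carrier) : A.Δ (A.parity x) = -A.parity (A.Δ x) := by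
  induction x using A.toGradedCx.induction with
  | h_hom n x hx =>
    rw [A.parity_apply hx, A.parity_apply (A.Δ_deg n x hx), map_smul, sgn_sub_one, neg_smul,
      neg_neg]
  | h_zero => simp
  | h_add x x' hx hx' => simp only [map_add, hx, hx']; abel

theorem IsBV1.mul_mem_ker {A : BVAlgebra.{u, v} K} (hA : A.IsBV1) {x y : A.carrier}
    (hx : A.Δ x = 0) (hy : A.Δ y = 0) : A.Δ (A.mul x y) = 0 := by
  simp [hA.Δ_mul_parity, hx, hy]

/-- The image of `Δ` is an ideal in its kernel. -/
theorem IsBV1.mul_mem_range_left {A : BVAlgebra.{u, v} K} (hA : A.IsBV1) {x y : A.carrier}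
    (hx : x ∈ LinearMap.range A.Δ) (hy : A.Δ y = 0) : A.mul x y ∈ LinearMap.range A.Δ := by
  obtain ⟨z, rfl⟩ := hx
  exact ⟨A.mul z y, by simp [hA.Δ_mul_parity, hy]⟩

/-- The image of `Δ` is an ideal in its kernel. -/
theorem IsBV1.mul_mem_range_right {A : BVAlgebra.{u, v} K} (hA : A.IsBV1) {x y : A.carrier}
    (hx : A.Δ x = 0) (hy : y ∈ LinearMap.range A.Δ) : A.mul x y ∈ LinearMap.range A.Δ := by
  obtain ⟨z, rfl⟩ := hy
  -- The parity twist on `x` cancels the Koszul sign that arises when `Δ` passes `x`.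
  exact ⟨A.mul (A.parity x) z, by simp [hA.Δ_mul_parity, A.Δ_parity, hx, A.parity_parity]⟩

theorem DDeltaCondition.mem_range {A : BVAlgebra.{u, v} K} (hA : A.DDeltaCondition)
    {x : A.carrier} (hx : A.Δ (A.d x) = 0) : A.d x ∈ LinearMap.range A.Δ := by
  have h : A.d x ∈ LinearMap.ker A.Δ ⊓ LinearMap.range A.d := ⟨hx, x, rfl⟩
  rw [← hA.1] at h
  exact h.2

theorem DDeltaCondition.exists_d {A : BVAlgebra.{u, v} K} (hA : A.DDeltaCondition)
    {x : A.carrier} (hx : A.Δ (A.d x) = 0) : ∃ y, A.d (A.Δ y) = A.d x := by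
  have h : A.d x ∈ LinearMap.ker A.Δ ⊓ LinearMap.range A.d := ⟨hx, x, rfl⟩
  rw [hA.2] at h
  exact h

end BVAlgebra

-- Contractions anticommuting with `Δ`

namespace BVAlgebra

variable {K : Type u} [Field K] {A : BVAlgebra.{u, v} K}

/-- A contracting homotopy of the non-closed part of `A`, which anticommutes with `Δ`. -/
theorem DDeltaCondition.exists_homotopy (hA : A.DDeltaCondition) :
    ∃ h : A.carrier →ₗ[K] A.carrier, (∀ n x, x ∈ A.deg n → h x ∈ A.deg (n - 1)) ∧
      (∀ x, h (A.Δ x) = -A.Δ (h x)) ∧ (∀ x, A.d (h (A.d x)) = A.d x) ∧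
      (∀ x, h (A.d (h x)) = h x) ∧ ∀ x, h (h x) = 0 := by
  obtain ⟨g, g_deg, hg⟩ := A.exists_graded_inverse (A.d ∘ₗ A.Δ) fun n x hx => by
    have h := A.d_deg _ _ (A.Δ_deg n x hx)
    rwa [sub_add_cancel] at h
  simp only [LinearMap.comp_apply] at hg
  -- a first homotopy
  obtain ⟨h₀, h₀_deg, h₀_Δ, d_h₀_d⟩ : ∃ h : A.carrier →ₗ[K] A.carrier,
      (∀ n x, x ∈ A.deg n → h x ∈ A.deg (n - 1)) ∧
      (∀ x, h (A.Δ x) = -A.Δ (h x)) ∧ (∀ x, A.d (h (A.d x)) = A.d x) := by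
    -- With `g` a generalized inverse of `dΔ`, both `hΔ` and `-Δh` equal `ΔgΔ`. Put `x' = x - g d Δ
    -- x`; then `d h d x = dΔg(d x') + d g d Δ x`. As `Δ d x' = 0`, the `dΔ`-condition puts `d x'`
    -- in `Im (dΔ)`, where `dΔg` is the identity, so the sum is `d x`.
    refine ⟨A.Δ ∘ₗ g + A.Δ ∘ₗ g ∘ₗ A.d ∘ₗ g ∘ₗ A.Δ - g ∘ₗ A.Δ, fun n x hx => ?_, fun x => ?_,
      fun x => ?_⟩
    · refine sub_mem (add_mem (A.Δ_deg _ _ (g_deg _ _ hx)) ?_) (g_deg _ _ (A.Δ_deg _ _ hx))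
      have h := A.Δ_deg _ _ (g_deg _ _ (A.d_deg _ _ (g_deg _ _ (A.Δ_deg _ _ hx))))
      rwa [sub_add_cancel] at h
    · simp [A.Δ_Δ]
    · have h1 : A.Δ (A.d (x - g (A.d (A.Δ x)))) = 0 := by
        simp [A.Δ_d, hg]
      obtain ⟨y, hy⟩ := hA.exists_d h1
      have h2 := hg y
      rw [hy] at h2
      simp only [map_sub] at h2
      simp only [LinearMap.add_apply, LinearMap.sub_apply, LinearMap.comp_apply, map_add, map_sub,
        A.Δ_d x, map_neg]
      rw [sub_eq_sub_iff_add_eq_add] at h2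
      rw [sub_neg_eq_add, ← sub_eq_add_neg, sub_add_eq_add_sub, h2]
      abel
  -- normalization
  let k : A.carrier →ₗ[K] A.carrier := h₀ ∘ₗ A.d ∘ₗ h₀
  have k_deg : ∀ n x, x ∈ A.deg n → k x ∈ A.deg (n - 1) := fun n x hx => by
    have h := h₀_deg _ _ (A.d_deg _ _ (h₀_deg _ _ hx))
    rwa [sub_add_cancel] at h
  have k_Δ : ∀ x, k (A.Δ x) = -A.Δ (k x) := fun x => by
    have h1 : ∀ y, A.d (A.Δ y) = -A.Δ (A.d y) := fun y => by rw [A.Δ_d, neg_neg]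
    simp [k, h₀_Δ, h1]
  have d_k_d : ∀ x, A.d (k (A.d x)) = A.d x := fun x => by simp [k, d_h₀_d]
  have k_d_k : ∀ x, k (A.d (k x)) = k x := fun x => by simp [k, d_h₀_d]
  clear_value k
  -- From `k d k = k` one gets `k²dk = k²` and `k²dk²d = k³d`, so the correction `k²d` makes the
  -- square vanish. Since `d² = 0`, it does not affect `h d`.
  refine ⟨k - k ∘ₗ k ∘ₗ A.d, fun n x hx => sub_mem (k_deg n x hx) ?_, fun x => ?_, fun x => ?_,
    fun x => ?_, fun x => ?_⟩
  · have h := k_deg _ _ (k_deg _ _ (A.d_deg _ _ hx))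
    rwa [add_sub_cancel_right] at h
  · have h1 : ∀ y, A.d (A.Δ y) = -A.Δ (A.d y) := fun y => by rw [A.Δ_d, neg_neg]
    simp [k_Δ, h1]; abel
  · simp [A.d_d, d_k_d]
  · simp [A.d_d, k_d_k]
  · simp [k_d_k]

/-- The homotopy transfer diagram defined by a contracting homotopy. -/
theorem exists_diagram_of_homotopy (X : GradedCx.{u, v} K) (h : X.carrier →ₗ[K] X.carrier)
    (h_deg : ∀ n x, x ∈ X.deg n → h x ∈ X.deg (n - 1)) (d_h_d : ∀ x, X.d (h (X.d x)) = X.d x)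
    (h_d_h : ∀ x, h (X.d (h x)) = h x) (h_h : ∀ x, h (h x) = 0) :
    ∃ D : HTDiagram X, D.h = h ∧ (∀ z : LinearMap.ker X.d, D.ρ z = Submodule.Quotient.mk z) ∧
      (∀ x, D.h (D.ι x) = 0) ∧ (∀ x, D.ρ (D.h x) = 0) := by
  -- The projection onto the harmonic part: it is idempotent and composes to zero with `d` and `h`
  -- on either side, so its image represents cohomology.
  let c : X.carrier →ₗ[K] X.carrier := LinearMap.id - X.d ∘ₗ h - h ∘ₗ X.d
  have hc : ∀ x, c x = x - X.d (h x) - h (X.d x) := fun x => rfl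
  have d_c : ∀ x, X.d (c x) = 0 := fun x => by simp [hc, X.d_d, d_h_d]
  have c_d : ∀ x, c (X.d x) = 0 := fun x => by simp [hc, X.d_d, d_h_d]
  have h_c : ∀ x, h (c x) = 0 := fun x => by simp [hc, h_h, h_d_h]
  have c_h : ∀ x, c (h x) = 0 := fun x => by simp [hc, h_h, h_d_h]
  have c_c : ∀ x, c (c x) = c x := fun x => by rw [hc (c x), h_c, d_c]; simp
  have c_deg : ∀ n x, x ∈ X.deg n → c x ∈ X.deg n := fun n x hx => by
    have h1 := X.d_deg _ _ (h_deg _ _ hx)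
    have h2 := h_deg _ _ (X.d_deg _ _ hx)
    rw [sub_add_cancel] at h1
    rw [add_sub_cancel_right] at h2
    exact sub_mem (sub_mem hx h1) h2
  let ι : X.Coh →ₗ[K] X.carrier := Submodule.liftQ _ (c ∘ₗ (LinearMap.ker X.d).subtype) (by
    rintro ⟨z, hz⟩ ⟨y, hy⟩
    simp only [Submodule.subtype_apply] at hy
    simp [← hy, c_d])
  let ρ : X.carrier →ₗ[K] X.Coh := Submodule.mkQ _ ∘ₗ c.codRestrict (LinearMap.ker X.d) d_c
  have ι_mk : ∀ z : LinearMap.ker X.d, ι (Submodule.Quotient.mk z) = c z := fun z => rfl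
  have ρ_mk : ∀ x, ρ x = Submodule.Quotient.mk ⟨c x, d_c x⟩ := fun x => rfl
  have ρ_ker : ∀ z : LinearMap.ker X.d, ρ z = Submodule.Quotient.mk z := fun z => by
    rw [ρ_mk, Submodule.Quotient.eq]
    refine ⟨-h z, ?_⟩
    have hz : X.d z = 0 := z.2
    simp [hc, hz]
  have ρ_ι : ∀ x, ρ (ι x) = x := fun x => by
    induction x using Submodule.Quotient.induction_on with
    | H z =>
      rw [ι_mk, ρ_mk]
      simp only [c_c]
      rw [← ρ_mk, ρ_ker]
  refine ⟨⟨ι, ρ, h, ?_, ?_, h_deg, ?_, ?_, ρ_ι, ?_⟩, rfl, ρ_ker, ?_, ?_⟩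
  · rintro n _ ⟨z, hz, rfl⟩
    exact c_deg n z hz
  · intro n x hx
    exact ⟨⟨c x, d_c x⟩, c_deg n x hx, rfl⟩
  · intro x
    induction x using Submodule.Quotient.induction_on with
    | H z => exact d_c z
  · intro x
    rw [ρ_mk, Submodule.Quotient.mk_eq_zero]
    exact ⟨0, by simp [c_d]⟩
  · intro x
    rw [ρ_mk, ι_mk]
    simp only [c_c]
    rw [hc]; abel
  · intro x
    induction x using Submodule.Quotient.induction_on with
    | H z => exact h_c z
  · intro x
    change ρ (h x) = 0
    rw [ρ_mk, Submodule.Quotient.mk_eq_zero]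
    exact ⟨0, by simp [c_h]⟩

theorem DDeltaCondition.exists_compatible (hA : A.DDeltaCondition) :
    ∃ D : HTDiagram A.toGradedCx, D.Compatible A ∧
      (∀ z : LinearMap.ker A.d, D.ρ z = Submodule.Quotient.mk z) ∧
      (∀ x, D.h (D.ι x) = 0) ∧ (∀ x, D.ρ (D.h x) = 0) ∧ (∀ x, D.h (D.h x) = 0) := by
  obtain ⟨h, h_deg, h_Δ, d_h_d, h_d_h, h_h⟩ := hA.exists_homotopy
  obtain ⟨D, rfl, h1, h2, h3⟩ :=
    exists_diagram_of_homotopy A.toGradedCx h h_deg d_h_d h_d_h h_h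
  -- The operator `ι ρ = 1 - d h - h d` commutes with `Δ`, because `Δ` anticommutes with both `d`
  -- and `h`.
  have hcomm : ∀ x, A.Δ (D.ι (D.ρ x)) = D.ι (D.ρ (A.Δ x)) := fun x => by
    have e : ∀ y, D.ι (D.ρ y) = y - (A.d (D.h y) + D.h (A.d y)) := fun y => by
      rw [D.homotopy y, sub_sub_cancel]
    have h5 : ∀ y, A.d (A.Δ y) = -A.Δ (A.d y) := fun y => by rw [A.Δ_d, neg_neg]
    simp [e, h_Δ, h5]
  have hρ : ∀ x, D.ρ (A.Δ x) = 0 := fun x => by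
    rw [← D.ρ_ι (D.ρ (A.Δ x)), ← hcomm]
    -- A closed element of `Im Δ` is exact by the `dΔ`-condition, so `ρ` kills it.
    have h4 : A.Δ (D.ι (D.ρ x)) ∈ LinearMap.ker A.d ⊓ LinearMap.range A.Δ := by
      refine ⟨?_, _, rfl⟩
      have := A.d_Δ (D.ι (D.ρ x))
      rwa [D.d_ι, map_zero, add_zero] at this
    rw [hA.1] at h4
    obtain ⟨y, hy⟩ := h4.2
    rw [← hy, D.ρ_d]
  refine ⟨D, ⟨fun x => ?_, hρ, fun x => by rw [h_Δ]; simp⟩, h1, h2, h3, h_h⟩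
  rw [← D.ρ_ι x, hcomm, hρ, map_zero]

end BVAlgebra

-- The dg subalgebra `Ker Δ`

namespace BVAlgebra

variable {K : Type u} [Field K] {A : BVAlgebra.{u, v} K}

/-- The subalgebra `Ker Δ`. -/
def kerΔ (A : BVAlgebra.{u, v} K) (hA : A.IsBV1) : BVAlgebra.{u, v} K where
  carrier := LinearMap.ker A.Δ
  deg n := (A.deg n).comap (LinearMap.ker A.Δ).subtype
  internal := by
    -- `Δ` is homogeneous, so its kernel contains the homogeneous components of its elements and
    -- inherits the grading.
    have hproj : ∀ n x, A.Δ (A.proj n x) = A.proj (n - 1) (A.Δ x) := by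
      intro n x
      induction x using A.toGradedCx.induction with
      | h_hom m x hx =>
        by_cases h : m = n
        · subst h
          rw [A.proj_self hx, A.proj_self (A.Δ_deg _ _ hx)]
        · rw [A.proj_ne hx h, A.proj_ne (A.Δ_deg _ _ hx) (by omega), map_zero]
      | h_zero => simp
      | h_add x y hx hy => simp only [map_add, hx, hy]
    have hker : ∀ n, ∀ x ∈ LinearMap.ker A.Δ, A.proj n x ∈ LinearMap.ker A.Δ := by
      intro n x hx
      rw [LinearMap.mem_ker] at hx ⊢
      rw [hproj, hx, map_zero]
    refine isInternal_of_proj _ (fun n => (A.proj n).restrict (hker n)) ?_ ?_ ?_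
    · intro n x hx
      exact Subtype.ext (A.proj_self hx)
    · intro m n x hx h
      exact Subtype.ext (A.proj_ne hx h)
    · intro x
      obtain ⟨s, hs⟩ := A.exists_sum_proj x
      have hx : ∑ n ∈ s, (A.proj n).restrict (hker n) x = x :=
        Subtype.ext (by simpa using hs s subset_rfl)
      rw [← hx]
      exact sum_mem fun n _ => Submodule.mem_iSup_of_mem n (A.proj_mem n x)
  d := A.d.restrict fun x hx => by
    rw [LinearMap.mem_ker] at hx ⊢
    rw [A.Δ_d, hx, map_zero, neg_zero]
  d_deg n x hx := A.d_deg n x hx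
  d_d x := Subtype.ext (A.d_d x)
  mul := LinearMap.mk₂ K (fun x y => ⟨A.mul x y, hA.mul_mem_ker x.2 y.2⟩)
    (fun _ _ _ => Subtype.ext (by simp)) (fun _ _ _ => Subtype.ext (by simp))
    (fun _ _ _ => Subtype.ext (by simp)) (fun _ _ _ => Subtype.ext (by simp))
  Δ := 0
  mul_deg p q x y hx hy := A.mul_deg p q x y hx hy
  Δ_deg _ _ _ := zero_mem _
  Δ_Δ _ := rfl
  d_Δ x := by simp
  mul_assoc x y z := Subtype.ext (A.mul_assoc x y z)
  mul_comm p q x y hx hy := Subtype.ext (A.mul_comm p q x y hx hy)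
  d_mul p x y hx := Subtype.ext (A.d_mul p x y hx)
  bracket_mul p q x y z hx hy := by simp [bvBracket]

/-- The inclusion of the subalgebra `Ker Δ`. -/
def kerΔIncl (A : BVAlgebra.{u, v} K) (hA : A.IsBV1) : BVHom (A.kerΔ hA) A where
  toLin := (LinearMap.ker A.Δ).subtype
  map_deg _ _ hx := hx
  map_d _ := rfl
  map_mul _ _ := rfl
  map_Δ x := (LinearMap.mem_ker.1 x.2).symm

end BVAlgebra

-- The algebra structure on cohomology, and formality

namespace HTDiagram

variable {K : Type u} [Field K] {A : BVAlgebra.{u, v} K}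

theorem ι_ρ {X : GradedCx.{u, v} K} (D : HTDiagram X) (x : X.carrier) :
    D.ι (D.ρ x) = x - X.d (D.h x) - D.h (X.d x) := by
  rw [sub_sub, D.homotopy x, sub_sub_cancel]

/-- The cohomology is graded. -/
theorem coh_isInternal {X : GradedCx.{u, v} K} (D : HTDiagram X) :
    DirectSum.IsInternal X.cohDeg := by
  -- The grading of `H` is read off from that of `A` through the degree-zero maps `ι` and `ρ`.
  refine isInternal_of_proj _ (fun n => D.ρ ∘ₗ X.proj n ∘ₗ D.ι) ?_ ?_ ?_
  · intro n x hx
    simp [X.proj_self (D.ι_deg n x hx), D.ρ_ι]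
  · intro m n x hx h
    simp [X.proj_ne (D.ι_deg m x hx) h]
  · intro x
    obtain ⟨s, hs⟩ := X.exists_sum_proj (D.ι x)
    rw [← D.ρ_ι x, ← hs s subset_rfl, map_sum]
    exact sum_mem fun n _ => Submodule.mem_iSup_of_mem n (D.ρ_deg n _ (X.proj_mem n _))

/-- The product on cohomology. -/
def cohMul (D : HTDiagram A.toGradedCx) : A.Coh →ₗ[K] A.Coh →ₗ[K] A.Coh :=
  (A.mul.compl₁₂ D.ι D.ι).compr₂ D.ρ

theorem cohMul_apply (D : HTDiagram A.toGradedCx) (x y : A.Coh) :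
    D.cohMul x y = D.ρ (A.mul (D.ι x) (D.ι y)) := rfl

theorem ι_cohMul (D : HTDiagram A.toGradedCx) (x y : A.Coh) :
    D.ι (D.cohMul x y) = A.mul (D.ι x) (D.ι y) - A.d (D.h (A.mul (D.ι x) (D.ι y))) := by
  rw [cohMul_apply, D.ι_ρ]
  simp [A.d_mul_parity, D.d_ι]

theorem ρ_mul_d_left (D : HTDiagram A.toGradedCx) {y : A.carrier} (hy : A.d y = 0)
    (x : A.carrier) : D.ρ (A.mul (A.d x) y) = 0 := by
  have h := A.d_mul_parity x y
  rw [hy, map_zero, add_zero] at h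
  rw [← h, D.ρ_d]

theorem ρ_mul_d_right (D : HTDiagram A.toGradedCx) {x : A.carrier} (hx : A.d x = 0)
    (y : A.carrier) : D.ρ (A.mul x (A.d y)) = 0 := by
  have hx' : A.d (A.parity x) = 0 := by
    rw [A.d_parity, hx, map_zero, neg_zero]
  have h := A.d_mul_parity (A.parity x) y
  rw [hx', A.parity_parity, map_zero, LinearMap.zero_apply, zero_add] at h
  rw [← h, D.ρ_d]

/-- `ι (μ(x, y))` differs from `ι x · ι y` by an exact element, and exact times closed is exact, so
associativity is inherited from `A` after applying `ρ`. -/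
theorem cohMul_assoc (D : HTDiagram A.toGradedCx) (x y z : A.Coh) :
    D.cohMul (D.cohMul x y) z = D.cohMul x (D.cohMul y z) := by
  rw [D.cohMul_apply (D.cohMul x y) z, D.cohMul_apply x (D.cohMul y z), D.ι_cohMul, D.ι_cohMul]
  simp only [map_sub, LinearMap.sub_apply, D.ρ_mul_d_left (D.d_ι z), D.ρ_mul_d_right (D.d_ι x),
    A.mul_assoc]

theorem cohMul_comm (D : HTDiagram A.toGradedCx) (p q : ℤ) (x y : A.Coh)
    (hx : x ∈ A.cohDeg p) (hy : y ∈ A.cohDeg q) :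
    D.cohMul x y = sgn K (p * q) • D.cohMul y x := by
  rw [cohMul_apply, A.mul_comm p q _ _ (D.ι_deg p x hx) (D.ι_deg q y hy), map_smul, cohMul_apply]

theorem cohMul_deg (D : HTDiagram A.toGradedCx) (p q : ℤ) (x y : A.Coh)
    (hx : x ∈ A.cohDeg p) (hy : y ∈ A.cohDeg q) : D.cohMul x y ∈ A.cohDeg (p + q) :=
  D.ρ_deg _ _ (A.mul_deg p q _ _ (D.ι_deg p x hx) (D.ι_deg q y hy))

/-- The cohomology as a BV-algebra with zero differential and zero operator. -/
def cohBV (D : HTDiagram A.toGradedCx) : BVAlgebra.{u, v} K where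
  carrier := A.Coh
  deg := A.cohDeg
  internal := D.coh_isInternal
  d := 0
  d_deg _ _ _ := zero_mem _
  d_d _ := rfl
  mul := D.cohMul
  Δ := 0
  mul_deg := D.cohMul_deg
  Δ_deg _ _ _ := zero_mem _
  Δ_Δ _ := rfl
  d_Δ x := by simp
  mul_assoc := D.cohMul_assoc
  mul_comm := D.cohMul_comm
  d_mul p x y hx := by simp
  bracket_mul p q x y z hx hy := by simp [bvBracket]

variable {D : HTDiagram A.toGradedCx}

theorem Compatible.h_Δ (hD : D.Compatible A) (x : A.carrier) : D.h (A.Δ x) = -A.Δ (D.h x) :=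
  eq_neg_of_add_eq_zero_left (hD.2.2 x)

theorem Compatible.h_mem_ker (hD : D.Compatible A) {x : A.carrier} (hx : A.Δ x = 0) :
    A.Δ (D.h x) = 0 := by
  rw [← neg_neg (A.Δ (D.h x)), ← hD.h_Δ, hx, map_zero, neg_zero]

theorem Compatible.h_mem_range (hD : D.Compatible A) {x : A.carrier}
    (hx : x ∈ LinearMap.range A.Δ) : D.h x ∈ LinearMap.range A.Δ := by
  obtain ⟨y, rfl⟩ := hx
  exact ⟨-D.h y, by rw [hD.h_Δ, map_neg]⟩

theorem Compatible.ρ_range (hD : D.Compatible A) {x : A.carrier}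
    (hx : x ∈ LinearMap.range A.Δ) : D.ρ x = 0 := by
  obtain ⟨y, rfl⟩ := hx
  exact hD.2.1 y

/-- The element is exact and, since `h` preserves `Ker Δ`, also killed by `Δ`; the `dΔ`-condition
applies. -/
theorem Compatible.d_h_mem_range (hA : A.DDeltaCondition) (hD : D.Compatible A) {x : A.carrier}
    (hx : A.Δ x = 0) : A.d (D.h x) ∈ LinearMap.range A.Δ :=
  hA.mem_range (by rw [A.Δ_d, hD.h_mem_ker hx, map_zero, neg_zero])

theorem Compatible.d_mem_range (hA : A.DDeltaCondition) {x : A.carrier}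
    (hx : A.Δ x = 0) : A.d x ∈ LinearMap.range A.Δ :=
  hA.mem_range (by rw [A.Δ_d, hx, map_zero, neg_zero])

/-- In `x - ι ρ x = d h x + h d x`, the first term and `d x` are exact and killed by `Δ`, hence in
`Im Δ`, and `h` preserves `Im Δ`. This is what makes `ρ` multiplicative on `Ker Δ`. -/
theorem Compatible.sub_ι_ρ_mem_range (hA : A.DDeltaCondition) (hD : D.Compatible A)
    {x : A.carrier} (hx : A.Δ x = 0) : x - D.ι (D.ρ x) ∈ LinearMap.range A.Δ := by
  rw [← D.homotopy]
  exact add_mem (hD.d_h_mem_range hA hx) (hD.h_mem_range (d_mem_range hA hx))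

/-- When `h ι = 0`, the homotopy maps `Ker Δ` to `Im Δ`. -/
theorem Compatible.h_mem_range_of_ker (hA : A.DDeltaCondition) (hD : D.Compatible A)
    (hι : ∀ x, D.h (D.ι x) = 0) {x : A.carrier} (hx : A.Δ x = 0) :
    D.h x ∈ LinearMap.range A.Δ := by
  -- Because `h ι = 0`, `h` takes the same value at `x` and at `x - ι ρ x`, which lies in `Im Δ`.
  have h := hD.h_mem_range (hD.sub_ι_ρ_mem_range hA hx)
  rwa [map_sub, hι, sub_zero] at h

/-- The projection from `Ker Δ` to cohomology. -/
def Compatible.kerΔProj (hA : A.IsBV1) (hdΔ : A.DDeltaCondition) (hD : D.Compatible A) :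
    BVHom (A.kerΔ hA) D.cohBV where
  toLin := D.ρ ∘ₗ (LinearMap.ker A.Δ).subtype
  map_deg n x hx := D.ρ_deg n _ hx
  map_d _ := D.ρ_d _
  map_mul x y := by
    have hx : A.Δ x.1 = 0 := x.2
    have hy : A.Δ y.1 = 0 := y.2
    change D.ρ (A.mul x.1 y.1) = D.ρ (A.mul (D.ι (D.ρ x.1)) (D.ι (D.ρ y.1)))
    -- The factors are replaced by their harmonic parts one at a time; each error is in the ideal
    -- `Im Δ`.
    have h1 := hD.ρ_range (hA.mul_mem_range_left (hD.sub_ι_ρ_mem_range hdΔ hx) hy)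
    have h2 := hD.ρ_range (hA.mul_mem_range_right (hD.1 (D.ρ x.1))
      (hD.sub_ι_ρ_mem_range hdΔ hy))
    simp only [map_sub, LinearMap.sub_apply] at h1 h2
    rw [sub_eq_zero.1 h1, sub_eq_zero.1 h2]
  map_Δ _ := by
    change D.ρ 0 = 0
    exact map_zero _

/-- The contraction restricts to `Ker Δ`: `h x` is a primitive there of an exact `x`, and `ι ρ y` is
a representative there of the class of `y`. -/
theorem Compatible.kerΔIncl_isQuasiIso (hA : A.IsBV1) (hD : D.Compatible A) :
    (A.kerΔIncl hA).toCxHom.IsQuasiIso := by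
  constructor
  · rintro ⟨x, hx⟩ hdx ⟨y, hy⟩
    have hdx' : A.d x = 0 := congrArg Subtype.val hdx
    have hy' : A.d y = x := hy
    refine ⟨⟨D.h x, hD.h_mem_ker hx⟩, Subtype.ext ?_⟩
    have h := D.homotopy x
    rw [hdx', ← hy', D.ρ_d, map_zero, map_zero, add_zero, sub_zero, hy'] at h
    exact h
  · intro y hy
    refine ⟨⟨D.ι (D.ρ y), hD.1 _⟩, Subtype.ext (D.d_ι _), D.h y, ?_⟩
    have h := D.homotopy y
    rwa [hy, map_zero, add_zero] at h

theorem Compatible.kerΔProj_isQuasiIso (hA : A.IsBV1) (hdΔ : A.DDeltaCondition)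
    (hD : D.Compatible A) : (hD.kerΔProj hA hdΔ).toCxHom.IsQuasiIso := by
  constructor
  · rintro ⟨x, hx⟩ hdx ⟨y, hy⟩
    have hdx' : A.d x = 0 := congrArg Subtype.val hdx
    have hy' : (0 : A.Coh) = D.ρ x := hy
    refine ⟨⟨D.h x, hD.h_mem_ker hx⟩, Subtype.ext ?_⟩
    have h := D.homotopy x
    rw [hdx', ← hy', map_zero, map_zero, add_zero, sub_zero] at h
    exact h
  · intro (y : A.Coh) _
    refine ⟨⟨D.ι y, hD.1 y⟩, Subtype.ext (D.d_ι y), 0, ?_⟩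
    change (0 : A.Coh) = y - D.ρ (D.ι y)
    rw [D.ρ_ι, sub_self]

theorem Compatible.isFormal (hA : A.IsBV1) (hdΔ : A.DDeltaCondition)
    (hD : D.Compatible A) : A.IsFormal :=
  ⟨D.cohBV, rfl, .trans _ _ _ (.symm _ _ (.rel _ _ ⟨A.kerΔIncl hA, hD.kerΔIncl_isQuasiIso hA⟩))
    (.rel _ _ ⟨hD.kerΔProj hA hdΔ, hD.kerΔProj_isQuasiIso hA hdΔ⟩)⟩

end HTDiagram

/-! ### Trees with few leaves -/

section trees

variable {α : Type v}

theorem RTree.leaves_leaf (a : α) : (RTree.leaf a).leaves = [a] := rfl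

theorem RTree.leaves_node (f : RForest α) : (RTree.node f).leaves = f.word.filterMap id := rfl

theorem RForest.filterMap_word_pair (t s : RTree α) :
    (RForest.pair t s).word.filterMap id = t.leaves ++ s.leaves := by
  simp [RForest.word, RTree.leaves]

theorem RForest.filterMap_word_cons (t : RTree α) (f : RForest α) :
    (RForest.cons t f).word.filterMap id = t.leaves ++ f.word.filterMap id := by
  simp [RForest.word, RTree.leaves]

theorem RForest.two_le_length_filterMap (f : RForest α) : 2 ≤ (f.word.filterMap id).length := by
  have h1 := f.word_length_le
  have h2 := List.length_filterMap_le id f.word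
  omega

theorem RForest.two_le_length : (f : RForest α) → 2 ≤ f.length
  | .pair _ _ => le_refl 2
  | .cons _ f => f.two_le_length.trans (Nat.le_succ _)

theorem RTree.one_le_length_leaves (t : RTree α) : 1 ≤ t.leaves.length := by
  have h1 := t.word_length_le
  unfold RTree.leaves
  omega

theorem RTree.eq_leaf_of_length {t : RTree α} (ht : t.leaves.length = 1) :
    ∃ a, t = .leaf a := by
  rcases t with a | f
  · exact ⟨a, rfl⟩
  · have := f.two_le_length_filterMap
    rw [RTree.leaves_node] at ht
    omega

theorem RForest.eq_pair_of_length {f : RForest α} (hf : (f.word.filterMap id).length = 2) :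
    ∃ a b, f = .pair (.leaf a) (.leaf b) := by
  rcases f with ⟨t, s⟩ | ⟨t, f⟩
  · have ht := t.one_le_length_leaves
    have hs := s.one_le_length_leaves
    rw [RForest.filterMap_word_pair, List.length_append] at hf
    obtain ⟨a, rfl⟩ := RTree.eq_leaf_of_length (t := t) (by omega)
    obtain ⟨b, rfl⟩ := RTree.eq_leaf_of_length (t := s) (by omega)
    exact ⟨a, b, rfl⟩
  · have ht := t.one_le_length_leaves
    have hs := f.two_le_length_filterMap
    rw [RForest.filterMap_word_cons, List.length_append] at hf
    omega

theorem RTree.eq_node_of_length {t : RTree α} (ht : t.leaves.length = 2) :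
    ∃ a b, t = .node (.pair (.leaf a) (.leaf b)) := by
  rcases t with a | f
  · simp [RTree.leaves_leaf] at ht
  · obtain ⟨a, b, rfl⟩ := RForest.eq_pair_of_length ht
    exact ⟨a, b, rfl⟩

/-- The trees with three leaves. -/
theorem RTree.eq_of_length_three {t : RTree α} (ht : t.leaves.length = 3) :
    (∃ a b c, t = .node (.cons (.leaf a) (.pair (.leaf b) (.leaf c)))) ∨
    (∃ a b c, t = .node (.pair (.node (.pair (.leaf a) (.leaf b))) (.leaf c))) ∨
    (∃ a b c, t = .node (.pair (.leaf a) (.node (.pair (.leaf b) (.leaf c))))) := by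
  rcases t with a | ⟨t, s⟩ | ⟨t, f⟩
  · simp [RTree.leaves_leaf] at ht
  · have h1 := t.one_le_length_leaves
    have h2 := s.one_le_length_leaves
    rw [RTree.leaves_node, RForest.filterMap_word_pair, List.length_append] at ht
    rcases (by omega : t.leaves.length = 2 ∧ s.leaves.length = 1 ∨
      t.leaves.length = 1 ∧ s.leaves.length = 2) with ⟨h3, h4⟩ | ⟨h3, h4⟩
    · obtain ⟨a, b, rfl⟩ := RTree.eq_node_of_length h3
      obtain ⟨c, rfl⟩ := RTree.eq_leaf_of_length h4
      exact Or.inr (Or.inl ⟨a, b, c, rfl⟩)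
    · obtain ⟨a, rfl⟩ := RTree.eq_leaf_of_length h3
      obtain ⟨b, c, rfl⟩ := RTree.eq_node_of_length h4
      exact Or.inr (Or.inr ⟨a, b, c, rfl⟩)
  · have h1 := t.one_le_length_leaves
    have h2 := f.two_le_length_filterMap
    rw [RTree.leaves_node, RForest.filterMap_word_cons, List.length_append] at ht
    obtain ⟨a, rfl⟩ := RTree.eq_leaf_of_length (t := t) (by omega)
    obtain ⟨b, c, rfl⟩ := RForest.eq_pair_of_length (f := f) (by omega)
    exact Or.inl ⟨a, b, c, rfl⟩

mutual
theorem RTree.leaves_map {β : Type u} (g : α → β) : (t : RTree α) →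
    (t.map g).leaves = t.leaves.map g
  | .leaf _ => rfl
  | .node f => RForest.filterMap_word_map g f
theorem RForest.filterMap_word_map {β : Type u} (g : α → β) : (f : RForest α) →
    (f.map g).word.filterMap id = (f.word.filterMap id).map g
  | .pair t s => by
      rw [RForest.map, RForest.filterMap_word_pair, RForest.filterMap_word_pair,
        RTree.leaves_map g t, RTree.leaves_map g s, List.map_append]
  | .cons t f => by
      rw [RForest.map, RForest.filterMap_word_cons, RForest.filterMap_word_cons,
        RTree.leaves_map g t, RForest.filterMap_word_map g f, List.map_append]
end

theorem RTree.Labelled.length_leaves {n : ℕ} {T : RTree (Fin n)} (hT : T.Labelled) :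
    T.leaves.length = n := by
  simpa using List.Perm.length_eq hT

theorem RTree.labelled_two : {T : RTree (Fin 2) | T.Labelled} =
    {.node (.pair (.leaf 0) (.leaf 1)), .node (.pair (.leaf 1) (.leaf 0))} := by
  ext T
  simp only [Set.mem_ofPred_eq, Set.mem_insert_iff, Set.mem_singleton_iff]
  constructor
  · intro hT
    obtain ⟨a, b, rfl⟩ := RTree.eq_node_of_length hT.length_leaves
    have h : [a, b].Perm [0, 1] := hT
    suffices h' : ∀ a b : Fin 2, [a, b].Perm [0, 1] → a = 0 ∧ b = 1 ∨ a = 1 ∧ b = 0 by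
      rcases h' a b h with ⟨rfl, rfl⟩ | ⟨rfl, rfl⟩
      · exact Or.inl rfl
      · exact Or.inr rfl
    decide
  · rintro (rfl | rfl)
    · exact List.Perm.refl _
    · exact List.Perm.swap _ _ _

end trees

/-! ### The operations `θ` on a subalgebra where `φ` vanishes -/

section theta

variable {K : Type u} [Field K] {V : Type v} [AddCommGroup V] [Module K V]
  {mul : V →ₗ[K] V →ₗ[K] V} {φ : V →ₗ[K] V} {Z : Submodule K V}

theorem pow_apply_eq_zero (hφ : ∀ x ∈ Z, φ x = 0) {n : ℕ} (hn : n ≠ 0) {x : V} (hx : x ∈ Z) :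
    (φ ^ n) x = 0 := by
  obtain ⟨m, rfl⟩ := Nat.exists_eq_succ_of_ne_zero hn
  rw [pow_succ, Module.End.mul_apply, hφ x hx, map_zero]

theorem pow_apply_mem (hφ : ∀ x ∈ Z, φ x = 0) (n : ℕ) {x : V} (hx : x ∈ Z) :
    (φ ^ n) x ∈ Z := by
  rcases eq_or_ne n 0 with rfl | hn
  · simpa using hx
  · rw [pow_apply_eq_zero hφ hn hx]; exact zero_mem _

mutual
theorem branchValue_mem (hmul : ∀ x ∈ Z, ∀ y ∈ Z, mul x y ∈ Z) (hφ : ∀ x ∈ Z, φ x = 0) :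
    (t : RTree V) → (∀ x ∈ t.leaves, x ∈ Z) → ∀ a, branchValue mul φ t a ∈ Z
  | .leaf x, ht, a => by
      rw [branchValue]
      exact Z.smul_mem _ (pow_apply_mem hφ _ (ht x (List.mem_singleton_self x)))
  | .node f, ht, a => by
      rw [branchValue]
      exact Z.neg_mem (sum_mem fun p _ =>
        Z.smul_mem _ (pow_apply_mem hφ _ (inputsValue_mem hmul hφ f ht p.2)))
theorem inputsValue_mem (hmul : ∀ x ∈ Z, ∀ y ∈ Z, mul x y ∈ Z) (hφ : ∀ x ∈ Z, φ x = 0) :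
    (f : RForest V) → (∀ x ∈ f.word.filterMap id, x ∈ Z) → ∀ b, inputsValue mul φ f b ∈ Z
  | .pair t s, hf, b => by
      rw [RForest.filterMap_word_pair] at hf
      rw [inputsValue]
      exact sum_mem fun p _ => hmul _
        (Z.smul_mem _ (branchValue_mem hmul hφ t
          (fun x hx => hf x (List.mem_append_left _ hx)) _)) _
        (Z.smul_mem _ (branchValue_mem hmul hφ s
          (fun x hx => hf x (List.mem_append_right _ hx)) _))
  | .cons t f, hf, b => by
      rw [RForest.filterMap_word_cons] at hf
      rw [inputsValue]
      exact sum_mem fun p _ => hmul _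
        (Z.smul_mem _ (branchValue_mem hmul hφ t
          (fun x hx => hf x (List.mem_append_left _ hx)) _)) _
        (inputsValue_mem hmul hφ f (fun x hx => hf x (List.mem_append_right _ hx)) _)
end

/-- The edge below an internal vertex carries `φ` to a power at least one, applied to an element of
`Z`. -/
theorem branchValue_node_eq_zero (hmul : ∀ x ∈ Z, ∀ y ∈ Z, mul x y ∈ Z)
    (hφ : ∀ x ∈ Z, φ x = 0) (f : RForest V) (hf : ∀ x ∈ f.word.filterMap id, x ∈ Z) (a : ℕ) :
    branchValue mul φ (.node f) a = 0 := by
  rw [branchValue, neg_eq_zero]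
  exact Finset.sum_eq_zero fun p _ => by
    rw [pow_apply_eq_zero hφ (by omega) (inputsValue_mem hmul hφ f hf p.2), smul_zero]

theorem branchValue_eq_zero (hmul : ∀ x ∈ Z, ∀ y ∈ Z, mul x y ∈ Z)
    (hφ : ∀ x ∈ Z, φ x = 0) (t : RTree V) (ht : ∀ x ∈ t.leaves, x ∈ Z) {a : ℕ} (ha : a ≠ 0) :
    branchValue mul φ t a = 0 := by
  rcases t with x | f
  · rw [branchValue, pow_apply_eq_zero hφ ha (ht x (List.mem_singleton_self x)), smul_zero]
  · exact branchValue_node_eq_zero hmul hφ f ht a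

theorem inputsValue_eq_zero (hmul : ∀ x ∈ Z, ∀ y ∈ Z, mul x y ∈ Z)
    (hφ : ∀ x ∈ Z, φ x = 0) : (f : RForest V) → (∀ x ∈ f.word.filterMap id, x ∈ Z) →
    ∀ b, b ≠ 0 → inputsValue mul φ f b = 0
  | .pair t s, hf, b, hb => by
      rw [RForest.filterMap_word_pair] at hf
      rw [inputsValue]
      refine Finset.sum_eq_zero fun p hp => ?_
      rw [Finset.HasAntidiagonal.mem_antidiagonal] at hp
      rcases (by omega : p.1 ≠ 0 ∨ p.2 ≠ 0) with h | h
      · simp [branchValue_eq_zero hmul hφ t (fun x hx => hf x (List.mem_append_left _ hx)) h]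
      · simp [branchValue_eq_zero hmul hφ s (fun x hx => hf x (List.mem_append_right _ hx)) h]
  | .cons t f, hf, b, hb => by
      rw [RForest.filterMap_word_cons] at hf
      rw [inputsValue]
      refine Finset.sum_eq_zero fun p hp => ?_
      rw [Finset.HasAntidiagonal.mem_antidiagonal] at hp
      rcases (by omega : p.1 ≠ 0 ∨ p.2 ≠ 0) with h | h
      · simp [branchValue_eq_zero hmul hφ t (fun x hx => hf x (List.mem_append_left _ hx)) h]
      · rw [inputsValue_eq_zero hmul hφ f (fun x hx => hf x (List.mem_append_right _ hx)) _ h,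
          map_zero]

theorem treeValue_pair_leaf (x y : V) :
    treeValue mul φ (.node (.pair (.leaf x) (.leaf y))) = (2 : K)⁻¹ • mul x y := by
  simp [treeValue, inputsValue, branchValue, vertexCoeff, RForest.length]

/-- On `Z` every `φ` gives zero, so a contributing tree has no internal edge and no `ψ`-class at a
leaf or the root. The exponents at its vertex must add up to `k - 2`, which forces `k = 2`. -/
theorem treeValue_eq_zero (hmul : ∀ x ∈ Z, ∀ y ∈ Z, mul x y ∈ Z)
    (hφ : ∀ x ∈ Z, φ x = 0) (T : RTree V) (hT : ∀ x ∈ T.leaves, x ∈ Z)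
    (h2 : T.leaves.length ≠ 2) : treeValue mul φ T = 0 := by
  rcases T with x | f
  · rw [treeValue]
  rw [treeValue]
  refine Finset.sum_eq_zero fun p hp => ?_
  rw [Finset.HasAntidiagonal.mem_antidiagonal] at hp
  by_cases h : p.1 = 0
  · suffices hi : inputsValue mul φ f p.2 = 0 by rw [hi, map_zero, smul_zero]
    by_cases h' : p.2 = 0
    · rcases f with ⟨t, s⟩ | ⟨t, f⟩
      · rw [RTree.leaves_node, RForest.filterMap_word_pair] at hT h2
        rw [h', inputsValue, Finset.HasAntidiagonal.antidiagonal_zero, Finset.sum_singleton]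
        rcases t with x | t
        · rcases s with y | s
          · simp [RTree.leaves_leaf] at h2
          · rw [branchValue_node_eq_zero hmul hφ s
              (fun x hx => hT x (List.mem_append_right _ hx)), smul_zero, map_zero]
        · rw [branchValue_node_eq_zero hmul hφ t
            (fun x hx => hT x (List.mem_append_left _ hx)), smul_zero, map_zero,
            LinearMap.zero_apply]
      -- With at least three inputs at the root the exponents `p.1` and `p.2` cannot both be zero.
      · have := f.two_le_length
        simp only [RForest.length] at hp
        omega
    · exact inputsValue_eq_zero hmul hφ f hT _ h'
  · rw [pow_apply_eq_zero hφ h (inputsValue_mem hmul hφ f hT p.2), smul_zero]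

theorem theta_eq_zero (hmul : ∀ x ∈ Z, ∀ y ∈ Z, mul x y ∈ Z)
    (hφ : ∀ x ∈ Z, φ x = 0) {n : ℕ} (hn : n ≠ 2) (e : Fin n → ℤ) (x : Fin n → V)
    (hx : ∀ i, x i ∈ Z) : theta mul φ n e x = 0 := by
  refine finsum_mem_eq_zero_of_forall_eq_zero (s := {T : RTree (Fin n) | T.Labelled})
    fun T hT => ?_
  rw [treeValue_eq_zero hmul hφ, smul_zero]
  · rw [RTree.leaves_map]
    simpa using fun i _ => hx i
  · rw [RTree.leaves_map, List.length_map, RTree.Labelled.length_leaves hT]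
    exact hn

/-- The binary corolla has two planar representatives, each weighted by `0!/2!`; there is no room
for `φ`. -/
theorem theta_two (e : Fin 2 → ℤ) (x : Fin 2 → V) :
    theta mul φ 2 e x =
      (2 : K)⁻¹ • (mul (x 0) (x 1) + sgn K (e 0 * e 1) • mul (x 1) (x 0)) := by
  have h : theta mul φ 2 e x = ∑ᶠ T ∈ {T : RTree (Fin 2) | T.Labelled},
    sgn K (listSign e T.leaves) • treeValue mul φ (T.map x) := rfl
  rw [h, RTree.labelled_two, finsum_mem_pair (by simp)]
  simp only [RTree.map, RForest.map, treeValue_pair_leaf]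
  have h1 : listSign e (RTree.node (.pair (.leaf 0) (.leaf 1))).leaves = 0 := by
    simp [RTree.leaves, RTree.word, RForest.word, listSign, wordSign]
  have h2 : listSign e (RTree.node (.pair (.leaf 1) (.leaf 0))).leaves = e 0 * e 1 := by
    simp [RTree.leaves, RTree.word, RForest.word, listSign, wordSign, mul_comm]
  rw [h1, h2, sgn_zero, one_smul, smul_add, smul_comm]

end theta

/-! ### Commutative algebras as hypercommutative algebras -/

section product

variable {K : Type u} [Field K] {V : Type v} [AddCommGroup V] [Module K V]

/-- The operations with the given product in arity two, and zero in all other arities. -/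
def productOps (mul : V →ₗ[K] V →ₗ[K] V) : (n : ℕ) → MultilinearMap K (fun _ : Fin n => V) V
  | 2 =>
    { toFun := fun x => mul (x 0) (x 1)
      map_update_add' := by
        intro _ m i x y
        fin_cases i <;> simp [Function.update]
      map_update_smul' := by
        intro _ m i c x
        fin_cases i <;> simp [Function.update] }
  | _ => 0

theorem productOps_two (mul : V →ₗ[K] V →ₗ[K] V) (x : Fin 2 → V) :
    productOps mul 2 x = mul (x 0) (x 1) := rfl

theorem productOps_of_ne (mul : V →ₗ[K] V →ₗ[K] V) {n : ℕ} (hn : n ≠ 2) :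
    productOps mul n = 0 := by
  unfold productOps
  split
  · exact absurd rfl hn
  · rfl

theorem applyList_productOps_pair (mul : V →ₗ[K] V →ₗ[K] V) (x y : V) :
    applyList (productOps mul) [x, y] = mul x y := rfl

theorem applyList_productOps_of_ne (mul : V →ₗ[K] V →ₗ[K] V) {l : List V} (hl : l.length ≠ 2) :
    applyList (productOps mul) l = 0 := by
  rw [applyList, productOps_of_ne mul hl, zero_apply]

/-- With more than three inputs in total, one of the two nested operations has arity different from
two. -/
theorem applyList_productOps_nested_left (mul : V →ₗ[K] V →ₗ[K] V) (x y z : V) {l l' : List V}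
    (hl : l.length + l'.length ≠ 0) :
    applyList (productOps mul) (applyList (productOps mul) (x :: y :: l) :: z :: l') = 0 := by
  rcases l' with _ | ⟨w, l'⟩
  · rw [applyList_productOps_of_ne mul (l := x :: y :: l) (by simp at hl ⊢; exact hl),
      applyList_productOps_pair, map_zero, LinearMap.zero_apply]
  · exact applyList_productOps_of_ne mul (by simp)

theorem applyList_productOps_nested_right (mul : V →ₗ[K] V →ₗ[K] V) (x y z : V) {l l' : List V}
    (hl : l.length + l'.length ≠ 0) :
    applyList (productOps mul) (x :: applyList (productOps mul) (y :: z :: l) :: l') = 0 := by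
  rcases l' with _ | ⟨w, l'⟩
  · rw [applyList_productOps_of_ne mul (l := y :: z :: l) (by simp at hl ⊢; exact hl),
      applyList_productOps_pair, map_zero]
  · exact applyList_productOps_of_ne mul (by simp)

end product

/-- The hypercommutative algebra given by the product of a BV-algebra and no other operation. -/
def BVAlgebra.toHycom {K : Type u} [Field K] (B : BVAlgebra.{u, v} K) : HycomAlgebra.{u, v} K where
  toGradedCx := B.toGradedCx
  m := productOps B.mul
  m_deg n _ e x hx := by
    by_cases h : n = 2
    · subst h
      have := B.mul_deg _ _ _ _ (hx 0) (hx 1)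
      simpa [Fin.sum_univ_two, productOps_two] using this
    · rw [productOps_of_ne _ h]; exact zero_mem _
  m_symm n _ e x hx σ := by
    by_cases h : n = 2
    · subst h
      rcases (by decide +revert : σ = 1 ∨ σ = Equiv.swap 0 1) with rfl | rfl
      · simp [List.ofFn_succ, listSign, wordSign, sgn_zero]
      · simp only [productOps_two, Equiv.swap_apply_left, Equiv.swap_apply_right]
        rw [B.mul_comm _ _ _ _ (hx 1) (hx 0)]
        simp [List.ofFn_succ, listSign, wordSign]
    · simp [productOps_of_ne _ h]
  d_m n _ e x hx := by
    by_cases h : n = 2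
    · subst h
      rw [Fin.sum_univ_two]
      simp only [productOps_two]
      rw [B.d_mul _ _ _ (hx 0)]
      have h1 : Finset.univ.filter (fun j : Fin 2 => j < 0) = ∅ := by decide
      have h2 : Finset.univ.filter (fun j : Fin 2 => j < 1) = {0} := by decide
      simp only [h1, h2, Finset.sum_empty, Finset.sum_singleton, sgn_zero, one_smul]
      simp
    · simp [productOps_of_ne _ h]
  assoc n e y _ := by
    rcases n with _ | n
    · have h : Finset.univ.filter (fun i : Fin (0 + 3) => 2 < i) = ∅ := by decide
      simp only [hycomLeft, hycomRight, h]
      simp [applyList_productOps_pair, B.mul_assoc]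
    -- The input labelled `3` must go to one of the two parts, so every term involves an operation
    -- that is not binary.
    · have key : ∀ S : Finset (Fin (n + 1 + 3)),
          S.card + (Finset.univ.filter (fun i : Fin (n + 1 + 3) => 2 < i) \ S).card ≠ 0 := by
        intro S h
        have h3 : (3 : Fin (n + 1 + 3)) ∈ Finset.univ.filter (fun i : Fin (n + 1 + 3) => 2 < i) := by
          rw [Finset.mem_filter, Fin.lt_def]
          refine ⟨Finset.mem_univ _, ?_⟩
          change 2 % (n + 1 + 3) < 3 % (n + 1 + 3)
          rw [Nat.mod_eq_of_lt (by omega), Nat.mod_eq_of_lt (by omega)]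
          omega
        by_cases hS : (3 : Fin (n + 1 + 3)) ∈ S
        · have := Finset.card_pos.2 ⟨_, hS⟩
          omega
        · have := Finset.card_pos.2 ⟨_, Finset.mem_sdiff.2 ⟨h3, hS⟩⟩
          omega
      rw [hycomLeft, hycomRight, Finset.sum_eq_zero, Finset.sum_eq_zero]
      · intro S _
        rw [applyList_productOps_nested_right _ _ _ _ (by simpa using key S), smul_zero]
      · intro S _
        rw [applyList_productOps_nested_left _ _ _ _ (by simpa using key S), smul_zero]

-- Homotopical triviality of the operations `θ_n`

namespace HTDiagram

variable {K : Type u} [Field K] {A : BVAlgebra.{u, v} K}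
  {D : HTDiagram A.toGradedCx}

theorem theta_eq_zero (hA : A.IsBV1) {n : ℕ} (hn : n ≠ 2)
    (e : Fin n → ℤ) (x : Fin n → A.carrier) (hx : ∀ i, A.Δ (x i) = 0) :
    theta A.mul (D.h ∘ₗ A.Δ) n e x = 0 :=
  BVHycom.theta_eq_zero (Z := LinearMap.ker A.Δ) (fun _ hx _ hy => hA.mul_mem_ker hx hy)
    (fun x hx => by rw [LinearMap.comp_apply, LinearMap.mem_ker.1 hx, map_zero]) hn e x hx

theorem theta_two_of_homogeneous [CharZero K] (φ : A.carrier →ₗ[K] A.carrier) (e : Fin 2 → ℤ)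
    (x : Fin 2 → A.carrier) (hx : ∀ i, x i ∈ A.deg (e i)) :
    theta A.mul φ 2 e x = A.mul (x 0) (x 1) := by
  rw [theta_two, ← A.mul_comm _ _ _ _ (hx 0) (hx 1), ← two_smul K, smul_smul,
    inv_mul_cancel₀ two_ne_zero, one_smul]

/-- The zigzag is `A ← Ker Δ → H` again, with the middle and right terms carrying only their
products: on `Ker Δ` the operations `θ_n` reduce to that. -/
theorem Compatible.hycomHomotopicallyTrivial [CharZero K] (hA : A.IsBV1) (hdΔ : A.DDeltaCondition)
    (hD : D.Compatible A) : HycomHomotopicallyTrivial A D := by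
  refine ⟨(A.kerΔ hA).toHycom, D.cohBV.toHycom, (A.kerΔIncl hA).toCxHom,
    ⟨(hD.kerΔProj hA hdΔ).toCxHom, fun n _ x => ?_⟩, ⟨rfl, fun n hn => ?_⟩,
    hD.kerΔIncl_isQuasiIso hA, hD.kerΔProj_isQuasiIso hA hdΔ, fun n _ e x hx => ?_⟩
  · by_cases h : n = 2
    · subst h
      exact (hD.kerΔProj hA hdΔ).map_mul (x 0) (x 1)
    · simp only [BVAlgebra.toHycom]
      rw [productOps_of_ne _ h, productOps_of_ne _ h]
      exact map_zero (D.ρ ∘ₗ (LinearMap.ker A.Δ).subtype)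
  · exact productOps_of_ne _ (by omega)
  · by_cases h : n = 2
    · subst h
      exact (theta_two_of_homogeneous _ e (fun i => (x i).1) hx).symm
    · refine Eq.trans ?_ (theta_eq_zero hA h e (fun i => (x i).1)
        fun i => LinearMap.mem_ker.1 (x i).2).symm
      simp only [BVAlgebra.toHycom]
      rw [productOps_of_ne _ h]
      exact map_zero (LinearMap.ker A.Δ).subtype

end HTDiagram

/-! ### The `Hycom_∞`-structure given by a product -/

section infinity

/-- Only a cut at the root leaves a single leaf behind. -/
theorem RTree.snd_of_leaf_mem_cuts {H : Type v} {op : RTree (ℤ × H) → H} {t : RTree (ℤ × H)} {s : ℤ}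
    {p : ℤ × H} (h : (s, RTree.leaf p) ∈ t.cuts op) : p.2 = op t := by
  rcases t with a | f
  · simp [RTree.cuts] at h
  · simp only [RTree.cuts, List.mem_cons, Prod.mk.injEq, List.mem_map] at h
    rcases h with h | ⟨_, _, _, h⟩
    · rw [RTree.leaf.inj h.2]
    · cases h

variable {K : Type u} [Field K] {H : Type v} [AddCommGroup H] [Module K H]

theorem sgn_of_even {p : ℤ} (hp : Even p) : sgn K p = 1 := hp.neg_one_zpow

theorem productOp_eq_zero (μ : H →ₗ[K] H →ₗ[K] H) {T : RTree (ℤ × H)}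
    (hT : T.leaves.length ≠ 2) : productOp μ T = 0 := by
  unfold productOp
  split
  · exact absurd rfl hT
  · rfl

theorem exists_of_productOp_ne_zero (μ : H →ₗ[K] H →ₗ[K] H) {T : RTree (ℤ × H)}
    (hT : productOp μ T ≠ 0) : ∃ p q, T = .node (.pair (.leaf p) (.leaf q)) := by
  unfold productOp at hT
  split at hT
  · exact ⟨_, _, rfl⟩
  · exact absurd rfl hT

/-- The square of the product is only seen on the binary trees with three leaves. -/
theorem length_of_mem_cuts (μ : H →ₗ[K] H →ₗ[K] H) {T : RTree (ℤ × H)}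
    {q : ℤ × RTree (ℤ × H)} (hq : q ∈ T.cuts (productOp μ)) (h : productOp μ q.2 ≠ 0) :
    T.leaves.length = 3 := by
  obtain ⟨p₁, p₂, hp⟩ := exists_of_productOp_ne_zero μ h
  have key : ∀ (t : RTree (ℤ × H)) (s : ℤ) (p : ℤ × H), (s, RTree.leaf p) ∈ t.cuts (productOp μ) →
      p.2 ≠ 0 → t.leaves.length = 2 := by
    intro t s p hs hp0
    rw [RTree.snd_of_leaf_mem_cuts hs] at hp0
    by_contra hne
    exact hp0 (productOp_eq_zero μ hne)
  rw [hp] at h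
  rcases T with a | f
  · simp [RTree.cuts] at hq
  simp only [RTree.cuts, List.mem_cons, List.mem_map] at hq
  rcases hq with rfl | ⟨q', hq', rfl⟩
  · cases hp
  obtain ⟨s', f'⟩ := q'
  simp only [RTree.node.injEq] at hp
  subst hp
  rcases f with ⟨t, s⟩ | ⟨t, f⟩
  · simp only [RForest.cuts, List.mem_append, List.mem_map, Prod.mk.injEq,
      RForest.pair.injEq] at hq'
    rw [RTree.leaves_node, RForest.filterMap_word_pair, List.length_append]
    rcases hq' with ⟨⟨d, t'⟩, ht', -, rfl, rfl⟩ | ⟨⟨d, t'⟩, ht', -, rfl, rfl⟩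
    -- The cut branch has become a leaf whose decoration is nonzero, as otherwise the outer product
    -- would vanish; so that branch had two leaves, and the other branch is a leaf.
    · rw [key t _ _ ht' fun h0 => h (by simp [productOp, h0])]
      rfl
    · rw [key s _ _ ht' fun h0 => h (by simp [productOp, h0])]
      rfl
  · simp [RForest.cuts] at hq'

theorem cutSquare_productOp_eq_zero (μ : H →ₗ[K] H →ₗ[K] H) {T : RTree (ℤ × H)}
    (hT : T.leaves.length ≠ 3) : cutSquare K (productOp μ) T = 0 := by
  refine List.sum_eq_zero fun y hy => ?_
  obtain ⟨q, hq, rfl⟩ := List.mem_map.1 hy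
  by_contra h
  exact hT (length_of_mem_cuts μ hq fun h0 => h (by rw [h0, smul_zero]))

-- The Koszul dual cooperad in arity three

/-- The functional which counts the binary trees with three leaves, on classes of trees. -/
def binaryCount (K : Type u) [Field K] : ExteriorAlgebra K (Finset (Fin 3) →₀ K) →ₗ[K] K :=
  ExteriorAlgebra.liftAlternating fun
    -- A two-form is needed because tree classes are exterior products. The determinant pairs the
    -- coefficient of the root vertex with the total coefficient of all other vertices, and so takes
    -- the value one on root times inner vertex.
    | 2 => (Matrix.detRowAlternating (R := K) (n := Fin 2)).compLinearMap (LinearMap.pi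
        ![Finsupp.lapply Finset.univ,
          Finsupp.linearCombination K fun U => if U = Finset.univ then 0 else 1])
    | _ => 0

theorem binaryCount_ι (m : Finset (Fin 3) →₀ K) :
    binaryCount K (ExteriorAlgebra.ι K m) = 0 := by
  rw [binaryCount, ExteriorAlgebra.liftAlternating_ι]; rfl

theorem binaryCount_mul {U : Finset (Fin 3)} (hU : U ≠ Finset.univ) :
    binaryCount K (ExteriorAlgebra.ι K (Finsupp.single Finset.univ (1 : K)) *
      ExteriorAlgebra.ι K (Finsupp.single U (1 : K))) = 1 := by
  have h := ExteriorAlgebra.ιMulti_apply (R := K)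
    ![Finsupp.single Finset.univ (1 : K), Finsupp.single U (1 : K)]
  simp only [List.ofFn_succ, List.ofFn_zero, List.prod_cons, List.prod_nil, mul_one,
    Matrix.cons_val_zero, Matrix.cons_val_succ, Fin.isValue] at h
  rw [← h, binaryCount, ExteriorAlgebra.liftAlternating_apply_ιMulti]
  refine (Matrix.det_fin_two (R := K) _).trans ?_
  simp [hU]

/-- The corolla with three leaves. -/
def corolla : RForest (Fin 3) := .cons (.leaf 0) (.pair (.leaf 1) (.leaf 2))

theorem corolla_labelled : (RTree.node corolla).Labelled := List.Perm.refl _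

theorem blocks_corolla : corolla.blocks = {{0}, {1}, {2}} := by
  simp [corolla, RForest.blocks, RTree.leaves_leaf]

theorem treeClass_corolla : treeClass K (.node corolla) =
    ExteriorAlgebra.ι K (Finsupp.single Finset.univ (1 : K)) := by
  have h : (RTree.node corolla).vertices = [Finset.univ] := by
    have : [0, 1, 2].toFinset = (Finset.univ : Finset (Fin 3)) := by decide
    rw [← this]; rfl
  simp [treeClass, h]

/-- With three branches, grouping `a` and `b` but not `c` can be done in only one way, so each
relation is a difference of two binary trees, each counted once. -/
theorem localRelations_le_ker : localRelations K (.node corolla) corolla ≤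
    LinearMap.ker (binaryCount K) := by
  have key : ∀ a ∈ corolla.blocks, ∀ b ∈ corolla.blocks, ∀ c ∈ corolla.blocks,
      a ≠ b → b ≠ c → a ≠ c →
      corolla.splits.filter (fun S => a ∈ S ∧ b ∈ S ∧ c ∉ S) = {{a, b}} ∧
      ({a, b} : Finset (Finset (Fin 3))).sup id ≠ Finset.univ := by
    rw [RForest.splits, blocks_corolla]
    decide
  rw [localRelations, Submodule.span_le]
  rintro r ⟨a, ha, b, hb, c, hc, hab, hbc, hac, rfl⟩
  obtain ⟨h1, h2⟩ := key a ha b hb c hc hab hbc hac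
  obtain ⟨h3, h4⟩ := key b hb c hc a ha hbc hac.symm hab.symm
  rw [SetLike.mem_coe, LinearMap.mem_ker, mul_sub, map_sub, splitSum, splitSum, h1, h3,
    Finset.sum_singleton, Finset.sum_singleton, treeClass_corolla, binaryCount_mul h2,
    binaryCount_mul h4, sub_self]

theorem perm_cases {a b c : Fin 3} (h : [a, b, c].Perm [0, 1, 2]) :
    (a = 0 ∧ b = 1 ∧ c = 2) ∨ (a = 0 ∧ b = 2 ∧ c = 1) ∨ (a = 1 ∧ b = 0 ∧ c = 2) ∨
    (a = 1 ∧ b = 2 ∧ c = 0) ∨ (a = 2 ∧ b = 0 ∧ c = 1) ∨ (a = 2 ∧ b = 1 ∧ c = 0) := by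
  revert h
  revert a b c
  decide

theorem toFinset_of_perm {a b c : Fin 3} (h : [a, b, c].Perm [0, 1, 2]) :
    [a, b, c].toFinset = Finset.univ := by
  rw [List.toFinset_eq_of_perm _ _ h]; decide

theorem vertices_cons {a b c : Fin 3}
    (h : (RTree.node (.cons (.leaf a) (.pair (.leaf b) (.leaf c)))).Labelled) :
    (RTree.node (.cons (.leaf a) (.pair (.leaf b) (.leaf c)))).vertices = [Finset.univ] := by
  rw [← toFinset_of_perm h]; rfl

theorem vertices_left {a b c : Fin 3}
    (h : (RTree.node (.pair (.node (.pair (.leaf a) (.leaf b))) (.leaf c))).Labelled) :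
    (RTree.node (.pair (.node (.pair (.leaf a) (.leaf b))) (.leaf c))).vertices =
      [Finset.univ, {a, b}] := by
  rw [← toFinset_of_perm h, (by simp : ({a, b} : Finset (Fin 3)) = [a, b].toFinset)]; rfl

theorem vertices_right {a b c : Fin 3}
    (h : (RTree.node (.pair (.leaf a) (.node (.pair (.leaf b) (.leaf c))))).Labelled) :
    (RTree.node (.pair (.leaf a) (.node (.pair (.leaf b) (.leaf c))))).vertices =
      [Finset.univ, {b, c}] := by
  rw [← toFinset_of_perm h, (by simp : ({b, c} : Finset (Fin 3)) = [b, c].toFinset)]; rfl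

theorem pair_ne_univ (a b : Fin 3) : ({a, b} : Finset (Fin 3)) ≠ Finset.univ := by
  revert a b; decide

theorem binaryCount_treeClass {T : RTree (Fin 3)} {U : Finset (Fin 3)} (hU : U ≠ Finset.univ)
    (hT : T.vertices = [Finset.univ, U]) : binaryCount K (treeClass K T) = 1 := by
  rw [treeClass, hT]
  simp [binaryCount_mul hU]

theorem binaryCount_treeClass_cons {T : RTree (Fin 3)} (hT : T.vertices = [Finset.univ]) :
    binaryCount K (treeClass K T) = 0 := by
  rw [treeClass, hT]
  simp [binaryCount_ι]

/-- Every binary tree with three leaves arises by splitting the corolla, so the remaining trees are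
planar corollas, which have one vertex and count zero. -/
theorem otherTrees_le_ker : otherTrees K (.node corolla) corolla ≤
    LinearMap.ker (binaryCount K) := by
  have hv : (RTree.node corolla).vertices = [Finset.univ] := vertices_cons corolla_labelled
  have hs : ∀ a b : Fin 3, a ≠ b → {{a}, {b}} ∈ corolla.splits ∧
      ({{a}, {b}} : Finset (Finset (Fin 3))).sup id = {a, b} := by
    rw [RForest.splits, blocks_corolla]
    decide
  have hno : ∀ {T : RTree (Fin 3)} {a b : Fin 3}, a ≠ b →
      (∀ S ∈ corolla.splits, T.vertices.toFinset ≠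
        insert (S.sup id) (RTree.node corolla).vertices.toFinset) →
      T.vertices ≠ [Finset.univ, {a, b}] := by
    intro T a b hab h hT
    obtain ⟨h1, h2⟩ := hs a b hab
    refine h _ h1 ?_
    rw [h2, hT, hv]
    simp [Finset.pair_comm]
  rw [otherTrees, Submodule.span_le]
  rintro r ⟨T, hT, hne, rfl⟩
  rw [SetLike.mem_coe, LinearMap.mem_ker]
  rcases RTree.eq_of_length_three hT.length_leaves with
    ⟨a, b, c, rfl⟩ | ⟨a, b, c, rfl⟩ | ⟨a, b, c, rfl⟩
  · exact binaryCount_treeClass_cons (vertices_cons hT)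
  · refine absurd (vertices_left hT) (hno ?_ hne)
    rcases perm_cases hT with h | h | h | h | h | h <;> rw [h.1, h.2.1] <;> decide
  · refine absurd (vertices_right hT) (hno ?_ hne)
    rcases perm_cases hT with h | h | h | h | h | h <;> rw [h.2.1, h.2.2] <;> decide

theorem IsKoszulDual.binaryCount_eq_zero {z : RTree (Fin 3) →₀ K} (hz : IsKoszulDual z) :
    binaryCount K (combClass z) = 0 :=
  sup_le localRelations_le_ker otherTrees_le_ker
    (hz.2 (.node corolla) corolla_labelled corolla (List.mem_cons_self))

variable {deg : ℤ → Submodule K H} {μ : H →ₗ[K] H →ₗ[K] H}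

-- The square of the product on three inputs

/-- The Koszul sign rule for products of three elements. -/
theorem sgn_smul_triple
    (hcomm : ∀ p q x y, x ∈ deg p → y ∈ deg q → μ x y = sgn K (p * q) • μ y x)
    (hassoc : ∀ x y z, μ (μ x y) z = μ x (μ y z)) {e : Fin 3 → ℤ} {x : Fin 3 → H}
    (hx : ∀ i, x i ∈ deg (e i)) {a b c : Fin 3} (h : [a, b, c].Perm [0, 1, 2]) :
    sgn K (listSign e [a, b, c]) • μ (μ (x a) (x b)) (x c) = μ (μ (x 0) (x 1)) (x 2) := by
  have h1 : ∀ a b c, μ (μ (x a) (x b)) (x c) = sgn K (e a * e b) • μ (μ (x b) (x a)) (x c) := by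
    intro a b c
    rw [hcomm _ _ _ _ (hx a) (hx b), map_smul, LinearMap.smul_apply]
  have h2 : ∀ a b c, μ (μ (x a) (x b)) (x c) = sgn K (e b * e c) • μ (μ (x a) (x c)) (x b) := by
    intro a b c
    rw [hassoc, hcomm _ _ _ _ (hx b) (hx c), map_smul, hassoc]
  have h3 : ∀ {p : ℤ} (v : H), Even p → sgn K p • v = v := fun v hp => by
    rw [sgn_of_even hp, one_smul]
  rcases perm_cases h with ⟨rfl, rfl, rfl⟩ | ⟨rfl, rfl, rfl⟩ | ⟨rfl, rfl, rfl⟩ |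
    ⟨rfl, rfl, rfl⟩ | ⟨rfl, rfl, rfl⟩ | ⟨rfl, rfl, rfl⟩
  · exact h3 _ ⟨0, by simp [listSign, wordSign]⟩
  · rw [h2 0 2 1, smul_smul, ← sgn_add]
    exact h3 _ ⟨e 1 * e 2, by simp [listSign, wordSign]; ring⟩
  · rw [h1 1 0 2, smul_smul, ← sgn_add]
    exact h3 _ ⟨e 1 * e 0, by simp [listSign, wordSign]⟩
  · rw [h2 1 2 0, h1 1 0 2, smul_smul, smul_smul, ← sgn_add, ← sgn_add]
    exact h3 _ ⟨e 1 * e 0 + e 2 * e 0, by simp [listSign, wordSign]; ring⟩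
  · rw [h1 2 0 1, h2 0 2 1, smul_smul, smul_smul, ← sgn_add, ← sgn_add]
    exact h3 _ ⟨e 2 * e 0 + e 2 * e 1, by simp [listSign, wordSign]; ring⟩
  · rw [h1 2 1 0, h2 1 2 0, h1 1 0 2, smul_smul, smul_smul, smul_smul, ← sgn_add, ← sgn_add,
      ← sgn_add]
    exact h3 _ ⟨e 2 * e 1 + e 2 * e 0 + e 1 * e 0, by simp [listSign, wordSign]; ring⟩

/-- The associator of the product, on labelled trees with three leaves. -/
theorem cutSquare_three
    (hcomm : ∀ p q x y, x ∈ deg p → y ∈ deg q → μ x y = sgn K (p * q) • μ y x)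
    (hassoc : ∀ x y z, μ (μ x y) z = μ x (μ y z)) {e : Fin 3 → ℤ} {x : Fin 3 → H}
    (hx : ∀ i, x i ∈ deg (e i)) {T : RTree (Fin 3)} (hT : T.Labelled) :
    sgn K (wordSign e T.word) • cutSquare K (productOp μ) (T.map fun i => (e i, x i)) =
      binaryCount K (treeClass K T) • -μ (μ (x 0) (x 1)) (x 2) := by
  rcases RTree.eq_of_length_three hT.length_leaves with
    ⟨a, b, c, rfl⟩ | ⟨a, b, c, rfl⟩ | ⟨a, b, c, rfl⟩
  · rw [binaryCount_treeClass_cons (vertices_cons hT)]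
    simp [cutSquare, RTree.map, RForest.map, RTree.cuts, RForest.cuts, productOp]
  · rw [binaryCount_treeClass (pair_ne_univ a b) (vertices_left hT),
      ← sgn_smul_triple hcomm hassoc hx hT]
    have h1 : wordSign e (RTree.node (.pair (.node (.pair (.leaf a) (.leaf b))) (.leaf c))).word =
      listSign e [a, b, c] := by
      simp [RTree.word, RForest.word, listSign, wordSign]
    rw [h1]
    simp [cutSquare, RTree.map, RForest.map, RTree.cuts, RForest.cuts, productOp, sgn_one]
  · rw [binaryCount_treeClass (pair_ne_univ b c) (vertices_right hT),
      ← sgn_smul_triple hcomm hassoc hx hT]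
    -- The leaf `a` precedes the odd inner vertex, which costs `e a`. The sign of the cut contains
    -- the same degree, so the two cancel and this shape contributes as the left one does.
    have h1 : wordSign e (RTree.node (.pair (.leaf a) (.node (.pair (.leaf b) (.leaf c))))).word =
      listSign e [a, b, c] + e a := by
      simp [RTree.word, RForest.word, listSign, wordSign]; ring
    rw [h1]
    simp [cutSquare, RTree.map, RForest.map, RTree.cuts, RForest.cuts, productOp, sgn_one,
      sgn_add, RTree.degree, smul_smul, mul_assoc, sgn_mul_self, hassoc]

theorem wordSign_smul_productOp
    (hcomm : ∀ p q x y, x ∈ deg p → y ∈ deg q → μ x y = sgn K (p * q) • μ y x)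
    {e : Fin 2 → ℤ} {x : Fin 2 → H} (hx : ∀ i, x i ∈ deg (e i)) {T : RTree (Fin 2)}
    (hT : T.Labelled) :
    sgn K (wordSign e T.word) • productOp μ (T.map fun i => (e i, x i)) = μ (x 0) (x 1) ∧
      treeClass K T = ExteriorAlgebra.ι K (Finsupp.single Finset.univ (1 : K)) := by
  have huniv : (Finset.univ : Finset (Fin 2)) = [0, 1].toFinset := by decide
  have huniv' : (Finset.univ : Finset (Fin 2)) = [1, 0].toFinset := by decide
  have hT' : T ∈ {T : RTree (Fin 2) | T.Labelled} := hT
  rw [RTree.labelled_two] at hT'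
  rcases hT' with rfl | rfl
  · constructor
    · simp [RTree.word, RForest.word, wordSign, RTree.map, RForest.map, productOp, sgn_zero]
    · rw [huniv, treeClass]
      exact mul_one _
  · constructor
    · rw [hcomm _ _ _ _ (hx 0) (hx 1), mul_comm]
      simp [RTree.word, RForest.word, wordSign, RTree.map, RForest.map, productOp]
    · rw [huniv', treeClass]
      exact mul_one _

/-- If on single trees the value depends only on the tree class, linearly and along one fixed
vector, the evaluation of a combination factors through its class. -/
theorem evalComb_eq {g : RTree (ℤ × H) → H} {n : ℕ} {z : RTree (Fin n) →₀ K}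
    (hz : IsTreeComb z) {e : Fin n → ℤ} {x : Fin n → H}
    (L : ExteriorAlgebra K (Finset (Fin n) →₀ K) →ₗ[K] K) (v : H)
    (h : ∀ T : RTree (Fin n), T.Labelled →
      sgn K (wordSign e T.word) • g (T.map fun i => (e i, x i)) = L (treeClass K T) • v) :
    evalComb g z e x = L (combClass z) • v := by
  rw [evalComb, combClass, Finsupp.sum, Finsupp.sum, map_sum, Finset.sum_smul]
  refine Finset.sum_congr rfl fun T hT => ?_
  rw [mul_smul, h T (hz T hT), map_smul, smul_assoc]

/-- A graded commutative product is a `Hycom_∞`-structure. -/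
theorem isHycomInfty_productOp
    (hdeg : ∀ p q x y, x ∈ deg p → y ∈ deg q → μ x y ∈ deg (p + q))
    (hcomm : ∀ p q x y, x ∈ deg p → y ∈ deg q → μ x y = sgn K (p * q) • μ y x)
    (hassoc : ∀ x y z, μ (μ x y) z = μ x (μ y z)) : IsHycomInfty deg (productOp μ) where
  op_leaf _ := rfl
  op_deg T hT := by
    by_cases h : T.leaves.length = 2
    · obtain ⟨p, q, rfl⟩ := RTree.eq_node_of_length h
      have h1 := hdeg _ _ _ _ (hT p (by simp [RTree.leaves, RTree.word, RForest.word]))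
        (hT q (by simp [RTree.leaves, RTree.word, RForest.word]))
      have h2 : (RTree.node (.pair (.leaf p) (.leaf q))).degree + 1 = p.1 + q.1 := by
        simp only [RTree.degree, RForest.degree, RForest.length]
        push_cast
        ring
      rw [h2]
      exact h1
    · rw [productOp_eq_zero μ h]
      exact zero_mem _
  op_linear n T hT e := by
    by_cases h : n = 2
    · subst h
      have hT' : T ∈ {T : RTree (Fin 2) | T.Labelled} := hT
      rw [RTree.labelled_two] at hT'
      rcases hT' with rfl | rfl
      · exact ⟨productOps μ 2, fun x _ => rfl⟩
      · exact ⟨productOps μ.flip 2, fun x _ => rfl⟩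
    · refine ⟨0, fun x _ => productOp_eq_zero μ ?_⟩
      rwa [RTree.leaves_map, List.length_map, hT.length_leaves]
  op_class n z hz hz0 e x hx := by
    by_cases h : n = 2
    -- In arity two all labelled trees have the same nonzero class and the same signed value, so a
    -- zero class means that the coefficients add up to zero.
    · subst h
      have h1 : evalComb (productOp μ) z e x = (z.sum fun _ c => c) • μ (x 0) (x 1) := by
        rw [evalComb, Finsupp.sum, Finsupp.sum, Finset.sum_smul]
        refine Finset.sum_congr rfl fun T hT => ?_
        rw [mul_smul, (wordSign_smul_productOp hcomm hx (hz T hT)).1]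
      have h2 : combClass z = (z.sum fun _ c => c) •
          ExteriorAlgebra.ι K (Finsupp.single Finset.univ (1 : K)) := by
        rw [combClass, Finsupp.sum, Finsupp.sum, Finset.sum_smul]
        refine Finset.sum_congr rfl fun T hT => ?_
        rw [(wordSign_smul_productOp hcomm hx (hz T hT)).2]
      rw [h2, smul_eq_zero, ExteriorAlgebra.ι_eq_zero_iff] at hz0
      rw [h1, hz0.resolve_right (by simp), zero_smul]
    · rw [evalComb_eq hz 0 0, LinearMap.zero_apply, zero_smul]
      intro T hT
      rw [productOp_eq_zero μ, smul_zero, smul_zero]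
      rwa [RTree.leaves_map, List.length_map, hT.length_leaves]
  square_zero n z hz e x hx := by
    by_cases h : n = 3
    · subst h
      rw [evalComb_eq hz.1 (binaryCount K) _ fun T hT => cutSquare_three hcomm hassoc hx hT,
        hz.binaryCount_eq_zero, zero_smul]
    · rw [evalComb_eq hz.1 0 0, LinearMap.zero_apply, zero_smul]
      intro T hT
      rw [cutSquare_productOp_eq_zero μ, smul_zero, smul_zero]
      rwa [RTree.leaves_map, List.length_map, hT.length_leaves]

/-! `Hycom_∞`-structures only depend on the values at homogeneous elements. -/

mutual
-- A cut keeps decorations homogeneous, because the new leaf carries a value of `op'` in exactly the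
-- degree recorded with it. The comparison therefore remains among homogeneous trees when the
-- operation is applied twice.
theorem RTree.cuts_congr {op op' : RTree (ℤ × H) → H}
    (hdeg : ∀ T, T.Homogeneous deg → op' T ∈ deg (T.degree + 1))
    (h : ∀ T, T.Homogeneous deg → op T = op' T) : (T : RTree (ℤ × H)) → T.Homogeneous deg →
    T.cuts op = T.cuts op' ∧ ∀ q ∈ T.cuts op', q.2.Homogeneous deg
  | .leaf p, _ => ⟨rfl, by simp [RTree.cuts]⟩
  | .node f, hT => by
      obtain ⟨h1, h2⟩ := RForest.cuts_congr hdeg h f hT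
      refine ⟨by rw [RTree.cuts, RTree.cuts, h1, h _ hT], fun q hq => ?_⟩
      simp only [RTree.cuts, List.mem_cons, List.mem_map] at hq
      rcases hq with rfl | ⟨q', hq', rfl⟩
      · intro p hp
        rw [List.mem_singleton.1 hp]
        exact hdeg _ hT
      · exact h2 q' hq'
theorem RForest.cuts_congr {op op' : RTree (ℤ × H) → H}
    (hdeg : ∀ T, T.Homogeneous deg → op' T ∈ deg (T.degree + 1))
    (h : ∀ T, T.Homogeneous deg → op T = op' T) : (f : RForest (ℤ × H)) →
    (∀ p ∈ f.word.filterMap id, p.2 ∈ deg p.1) →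
    f.cuts op = f.cuts op' ∧ ∀ q ∈ f.cuts op', ∀ p ∈ q.2.word.filterMap id, p.2 ∈ deg p.1
  | .pair t s, hf => by
      rw [RForest.filterMap_word_pair] at hf
      have ht := fun p hp => hf p (List.mem_append_left _ hp)
      have hs := fun p hp => hf p (List.mem_append_right _ hp)
      obtain ⟨h1, h2⟩ := RTree.cuts_congr hdeg h t ht
      obtain ⟨h3, h4⟩ := RTree.cuts_congr hdeg h s hs
      refine ⟨by rw [RForest.cuts, RForest.cuts, h1, h3], fun q hq => ?_⟩
      simp only [RForest.cuts, List.mem_append, List.mem_map] at hq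
      rcases hq with ⟨q', hq', rfl⟩ | ⟨q', hq', rfl⟩ <;> intro p hp <;>
        rw [RForest.filterMap_word_pair, List.mem_append] at hp
      · exact hp.elim (h2 q' hq' p) (hs p)
      · exact hp.elim (ht p) (h4 q' hq' p)
  | .cons t f, hf => by
      rw [RForest.filterMap_word_cons] at hf
      have ht := fun p hp => hf p (List.mem_append_left _ hp)
      have hs := fun p hp => hf p (List.mem_append_right _ hp)
      obtain ⟨h1, h2⟩ := RTree.cuts_congr hdeg h t ht
      obtain ⟨h3, h4⟩ := RForest.cuts_congr hdeg h f hs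
      refine ⟨by rw [RForest.cuts, RForest.cuts, h1, h3], fun q hq => ?_⟩
      simp only [RForest.cuts, List.mem_append, List.mem_map] at hq
      rcases hq with ⟨q', hq', rfl⟩ | ⟨q', hq', rfl⟩ <;> intro p hp <;>
        rw [RForest.filterMap_word_cons, List.mem_append] at hp
      · exact hp.elim (h2 q' hq' p) (hs p)
      · exact hp.elim (ht p) (h4 q' hq' p)
end

theorem IsHycomInfty.congr {op op' : RTree (ℤ × H) → H} (hop : IsHycomInfty deg op')
    (h_leaf : ∀ p, op (.leaf p) = 0) (h : ∀ T, T.Homogeneous deg → op T = op' T) :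
    IsHycomInfty deg op := by
  have hmap : ∀ {n : ℕ} (T : RTree (Fin n)) (e : Fin n → ℤ) (x : Fin n → H),
      (∀ i, x i ∈ deg (e i)) → (T.map fun i => (e i, x i)).Homogeneous deg := by
    intro n T e x hx p hp
    rw [RTree.leaves_map] at hp
    obtain ⟨i, _, rfl⟩ := List.mem_map.1 hp
    exact hx i
  have heval : ∀ {g g' : RTree (ℤ × H) → H}, (∀ T, T.Homogeneous deg → g T = g' T) →
      ∀ {n : ℕ} (z : RTree (Fin n) →₀ K) (e : Fin n → ℤ) (x : Fin n → H),
      (∀ i, x i ∈ deg (e i)) → evalComb g z e x = evalComb g' z e x := by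
    intro g g' hg n z e x hx
    refine Finset.sum_congr rfl fun T _ => ?_
    simp only [hg _ (hmap T e x hx)]
  have hcut : ∀ T : RTree (ℤ × H), T.Homogeneous deg → cutSquare K op T = cutSquare K op' T := by
    intro T hT
    obtain ⟨h1, h2⟩ := RTree.cuts_congr hop.op_deg h T hT
    rw [cutSquare, cutSquare, h1]
    congr 1
    refine List.map_congr_left fun q hq => ?_
    rw [h _ (h2 q hq)]
  refine ⟨h_leaf, fun T hT => ?_, fun n T hT e => ?_, fun n z hz hz0 e x hx => ?_,
    fun n z hz e x hx => ?_⟩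
  · rw [h T hT]
    exact hop.op_deg T hT
  · obtain ⟨M, hM⟩ := hop.op_linear n T hT e
    exact ⟨M, fun x hx => by rw [h _ (hmap T e x hx), hM x hx]⟩
  · rw [heval h z e x hx]
    exact hop.op_class n z hz hz0 e x hx
  · rw [heval hcut z e x hx]
    exact hop.square_zero n z hz e x hx

end infinity

/-! ### The transferred structure -/

namespace HTDiagram

variable {K : Type u} [Field K] {A : BVAlgebra.{u, v} K} {D : HTDiagram A.toGradedCx}

theorem thetaList_mem_ker (hA : A.IsBV1) {l : List (ℤ × A.carrier)} (hl : ∀ p ∈ l, A.Δ p.2 = 0) :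
    A.Δ (thetaList A.mul (D.h ∘ₗ A.Δ) l) = 0 := by
  by_cases h : l.length = 2
  · obtain ⟨p, q, rfl⟩ := List.length_eq_two.1 h
    have hp := hl p (by simp)
    have hq := hl q (by simp)
    have h' : thetaList A.mul (D.h ∘ₗ A.Δ) [p, q] =
      (2 : K)⁻¹ • (A.mul p.2 q.2 + sgn K (p.1 * q.1) • A.mul q.2 p.2) := theta_two _ _
    rw [h']
    simp [hA.mul_mem_ker hp hq, hA.mul_mem_ker hq hp]
  · rw [thetaList, theta_eq_zero hA h _ _ fun i => hl _ (List.get_mem l i), map_zero]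

mutual
-- The leaves start in `Ker Δ` since `Δ ι = 0`, and products and `h` do not leave it.
theorem Compatible.transferTree_mem_ker (hA : A.IsBV1) (hD : D.Compatible A) :
    (T : RTree (ℤ × A.Coh)) → A.Δ (transferTree A D T).2 = 0
  | .leaf p => by rw [transferTree]; exact hD.1 p.2
  | .node f => by
      rw [transferTree]
      exact hD.h_mem_ker (thetaList_mem_ker hA (hD.transferForest_mem_ker hA f))
theorem Compatible.transferForest_mem_ker (hA : A.IsBV1) (hD : D.Compatible A) :
    (f : RForest (ℤ × A.Coh)) → ∀ p ∈ transferForest A D f, A.Δ p.2 = 0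
  | .pair t s => by
      have ht := hD.transferTree_mem_ker hA t
      have hs := hD.transferTree_mem_ker hA s
      simp [transferForest, ht, hs]
  | .cons t f => by
      have ht := hD.transferTree_mem_ker hA t
      have hf := hD.transferForest_mem_ker hA f
      rw [transferForest]
      exact List.forall_mem_cons.2 ⟨ht, hf⟩
end

theorem Compatible.transferTree_node_mem_range (hA : A.IsBV1) (hdΔ : A.DDeltaCondition)
    (hD : D.Compatible A) (hι : ∀ x, D.h (D.ι x) = 0) (f : RForest (ℤ × A.Coh)) :
    (transferTree A D (.node f)).2 ∈ LinearMap.range A.Δ := by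
  rw [transferTree]
  exact hD.h_mem_range_of_ker hdΔ hι (thetaList_mem_ker hA (hD.transferForest_mem_ker hA f))

theorem length_transferForest : (f : RForest (ℤ × A.Coh)) →
    (transferForest A D f).length = f.length
  | .pair _ _ => rfl
  | .cons _ f => congrArg (· + 1) (length_transferForest f)

/-- A branch with a vertex ends in `h`, hence lies in `Im Δ`, and a product with it dies under `ρ`.
A root with three or more inputs gives zero because `θ_k` vanishes on `Ker Δ`. -/
theorem Compatible.transferredOp_eq [CharZero K] (hA : A.IsBV1) (hdΔ : A.DDeltaCondition)
    (hD : D.Compatible A) (hι : ∀ x, D.h (D.ι x) = 0) {T : RTree (ℤ × A.Coh)}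
    (hT : T.Homogeneous A.cohDeg) : transferredOp A D T = productOp D.cohMul T := by
  have htwo : ∀ t s : RTree (ℤ × A.Coh), transferredOp A D (.node (.pair t s)) =
      D.ρ ((2 : K)⁻¹ • (A.mul (transferTree A D t).2 (transferTree A D s).2 +
        sgn K ((transferTree A D t).1 * (transferTree A D s).1) •
          A.mul (transferTree A D s).2 (transferTree A D t).2)) := fun t s =>
    congrArg D.ρ (theta_two (fun i => ([transferTree A D t, transferTree A D s].get i).1)
      fun i => ([transferTree A D t, transferTree A D s].get i).2)
  have hzero : ∀ t s : RTree (ℤ × A.Coh), ((transferTree A D t).2 ∈ LinearMap.range A.Δ ∨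
      (transferTree A D s).2 ∈ LinearMap.range A.Δ) →
      transferredOp A D (.node (.pair t s)) = 0 := by
    intro t s h
    have ht := hD.transferTree_mem_ker hA t
    have hs := hD.transferTree_mem_ker hA s
    rw [htwo]
    refine hD.ρ_range (Submodule.smul_mem _ _ (add_mem ?_ (Submodule.smul_mem _ _ ?_)))
    · exact h.elim (hA.mul_mem_range_left · hs) (hA.mul_mem_range_right ht ·)
    · exact h.elim (hA.mul_mem_range_right hs ·) (hA.mul_mem_range_left · ht)
  rcases T with p | ⟨t, s⟩ | ⟨t, f⟩
  · rfl
  · rcases t with p | t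
    · rcases s with q | s
      · have hp := D.ι_deg _ _ (hT p (by simp [RTree.leaves, RTree.word, RForest.word]))
        have hq := D.ι_deg _ _ (hT q (by simp [RTree.leaves, RTree.word, RForest.word]))
        -- Homogeneity enters here: the symmetrization in `θ_2` collapses to the product only when
        -- the recorded degrees are the true ones.
        have h1 := theta_two_of_homogeneous (D.h ∘ₗ A.Δ) ![p.1, q.1] ![D.ι p.2, D.ι q.2]
          (by intro i; fin_cases i; exacts [hp, hq])
        rw [theta_two] at h1
        rw [htwo]
        exact congrArg D.ρ h1
      · exact hzero _ _ (Or.inr (hD.transferTree_node_mem_range hA hdΔ hι s))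
    · refine (hzero _ _ (Or.inl (hD.transferTree_node_mem_range hA hdΔ hι t))).trans ?_
      rfl
  · have h : (transferForest A D (.cons t f)).length ≠ 2 := by
      have := f.two_le_length
      rw [length_transferForest, RForest.length]
      omega
    rw [transferredOp, thetaList, theta_eq_zero hA h _ _ fun i =>
      hD.transferForest_mem_ker hA _ _ (List.get_mem _ i), map_zero]
    rfl

end HTDiagram

end BVHycom
end

-- The main theorem

theorem mainTheorem6 {K : Type u} [Field K] [CharZero K] (A : BVHycom.BVAlgebra.{u, v} K)
    (hBV1 : A.IsBV1) (hdΔ : A.DDeltaCondition) :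
    -- formality
    A.IsFormal ∧
    -- compatible homotopy transfer diagrams exist
    (∃ D : BVHycom.HTDiagram A.toGradedCx, D.Compatible A ∧
      (∀ z : LinearMap.ker A.d, D.ρ z = Submodule.Quotient.mk z) ∧
      (∀ x, D.h (D.ι x) = 0) ∧ (∀ x, D.ρ (D.h x) = 0) ∧ (∀ x, D.h (D.h x) = 0)) ∧
    -- the hypercommutative structure on `A` that such a diagram defines is homotopically trivial
    (∀ D : BVHycom.HTDiagram A.toGradedCx, D.Compatible A →
      BVHycom.HycomHomotopicallyTrivial A D) ∧
    -- the transferred structure on the cohomology is the trivial one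
    (∀ D : BVHycom.HTDiagram A.toGradedCx, D.Compatible A → (∀ x, D.h (D.ι x) = 0) →
      BVHycom.IsHycomInfty A.cohDeg (BVHycom.transferredOp A D) ∧
      ∃ μ : A.Coh →ₗ[K] A.Coh →ₗ[K] A.Coh,
        (∀ x y, A.mul (D.ι x) (D.ι y) - D.ι (μ x y) ∈ LinearMap.range A.d) ∧
        ∀ T : BVHycom.RTree (ℤ × A.Coh), T.Homogeneous A.cohDeg →
          BVHycom.transferredOp A D T = BVHycom.productOp μ T) := by
  refine ⟨?_, hdΔ.exists_compatible, fun D hD => hD.hycomHomotopicallyTrivial hBV1 hdΔ,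
    fun D hD hι => ⟨?_, D.cohMul, fun x y => ?_, fun T hT => hD.transferredOp_eq hBV1 hdΔ hι hT⟩⟩
  · obtain ⟨D, hD, -⟩ := hdΔ.exists_compatible
    exact hD.isFormal hBV1 hdΔ
  -- The transferred operation agrees with the product operation on homogeneous trees, which is
  -- enough for the axioms.
  · exact (BVHycom.isHycomInfty_productOp D.cohMul_deg D.cohMul_comm D.cohMul_assoc).congr
      (fun _ => rfl) fun T hT => hD.transferredOp_eq hBV1 hdΔ hι hT
  · rw [D.ι_cohMul, sub_sub_cancel]
    exact ⟨_, rfl⟩
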